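/- Let $(M,\varphi,\xi,\eta,g)$ be an almost contact metric structure on a connected smooth (Hausdorff) manifold of dimension $2n+1\ge 5$: $g$ is a Riemannian metric, $\varphi$ a $(1,1)$-tensor field, $\xi$ a vector field, $\eta$ a 1-form, with $\eta(\xi)=1$, $\varphi^2X=-X+\eta(X)\xi$ and $g(\varphi X,\varphi Y)=g(X,Y)-\eta(X)\eta(Y)$ (all smooth). Assume that it is contact metric, i.e. $d\eta(X,Y)=g(X,\varphi Y)$, where $2\,d\eta(X,Y)=X\eta(Y)-Y\eta(X)-\eta([X,Y])$. Put $h=\frac12 L_\xi\varphi$, let $R(X,Y)Z=\nabla_X\nabla_YZ-\nabla_Y\nabla_XZ-\nabla_{[X,Y]}Z$ be the Riemann curvature tensor of $g$, and define $$\begin{aligned} R_1(X,Y)Z&=g(Y,Z)X-g(X,Z)Y,\\ R_2(X,Y)Z&=g(X,\varphi Z)\varphi Y-g(Y,\varphi Z)\varphi X+2g(X,\varphi Y)\varphi Z,\\ R_3(X,Y)Z&=\eta(X)\eta(Z)Y-\eta(Y)\eta(Z)X+g(X,Z)\eta(Y)\xi-g(Y,Z)\eta(X)\xi,\\ R_4(X,Y)Z&=g(Y,Z)hX-g(X,Z)hY+g(hY,Z)X-g(hX,Z)Y,\\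 R_5(X,Y)Z&=g(hY,Z)hX-g(hX,Z)hY+g(\varphi hX,Z)\varphi hY-g(\varphi hY,Z)\varphi hX,\\ R_6(X,Y)Z&=\eta(X)\eta(Z)hY-\eta(Y)\eta(Z)hX+g(hX,Z)\eta(Y)\xi-g(hY,Z)\eta(X)\xi,\\ R_7(X,Y)Z&=g(Y,Z)\varphi hX-g(X,Z)\varphi hY+g(\varphi hY,Z)X-g(\varphi hX,Z)Y,\\ R_8(X,Y)Z&=\eta(X)\eta(Z)\varphi hY-\eta(Y)\eta(Z)\varphi hX+g(\varphi hX,Z)\eta(Y)\xi-g(\varphi hY,Z)\eta(X)\xi. \end{aligned}$$ Suppose that $M$ is a generalized $(\kappa,\mu,\nu)$-space form, i.e. $R=f_1R_1+\dots+f_8R_8$ for some smooth functions $f_1,\dots,f_8$ on $M$, and that $h$ does not vanish identically (the non-Sasakian case). Then $f_6$ is a constant $>-1$ and $$f_1=\frac{f_6+1}{2},\quad f_2=\frac{f_6-1}{2},\quad f_3=\frac{3f_6+1}{2},\quad f_4=1,\quad f_5=\frac12,\quad f_7=f_8=0.$$ If $\kappa,\mu,\nu$ are functions on $M$ with $$R(X,Y)\xi=\kappa\{\eta(Y)X-\eta(X)Y\}+\mu\{\eta(Y)hX-\eta(X)hY\}+\nu\{\eta(Y)\varphi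 hX-\eta(X)\varphi hY\}$$ for all $X,Y$, then $\kappa=-f_6$ (hence $\kappa<1$), $\mu=1-f_6$ (hence $\mu<2$) and $\nu=0$. Moreover $M$ is a $(-f_6,1-f_6)$-space, i.e. the displayed equation does hold with these constants $\kappa,\mu$ and $\nu=0$, and $M$ has constant $\varphi$-sectional curvature $F=2f_6-1$ (hence $F>-3$): $g(R(X,\varphi X)\varphi X,X)=2f_6-1$ for every unit vector $X$ orthogonal to $\xi$. -/

import Mathlib

open Bundle Manifold VectorField FiberBundle
open scoped ContDiff Topology

noncomputable section

namespace ContactGeometry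

set_option linter.unusedSectionVars false

/-! ### The Levi-Civita connection of a Riemannian manifold -/

variable {E : Type*} [NormedAddCommGroup E] [NormedSpace ℝ E] [FiniteDimensional ℝ E]
  [CompleteSpace E]
  {H : Type*} [TopologicalSpace H] {I : ModelWithCorners ℝ E H}
  {M : Type*} [TopologicalSpace M] [ChartedSpace H M] [IsManifold I ∞ M]
  [RiemannianBundle (fun x : M => TangentSpace I x)]
  [IsContMDiffRiemannianBundle I ∞ E (fun x : M => TangentSpace I x)]

/-- The function `g(X, Y)`. -/
def metric (X Y : Π x : M, TangentSpace I x) : M → ℝ := fun x => inner ℝ (X x) (Y x)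

/-- The derivative `X f` of the function `f` along the vector field `X`. -/
def dirDeriv (X : Π x : M, TangentSpace I x) (f : M → ℝ) : M → ℝ :=
  fun x => mvfderiv I f x (X x)

/-- The right-hand side of the Koszul formula for `g(∇_X Y, Z)`. -/
def koszul (Y X Z : Π x : M, TangentSpace I x) (x : M) : ℝ :=
  (1 / 2 : ℝ) * (dirDeriv X (metric Y Z) x + dirDeriv Y (metric X Z) x
    - dirDeriv Z (metric X Y) x + inner ℝ (mlieBracket I X Y x) (Z x)
    - inner ℝ (mlieBracket I X Z x) (Y x) - inner ℝ (mlieBracket I Y Z x) (X x))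

lemma metric_diff {X Y : Π x : M, TangentSpace I x} {x : M} (hX : MDiffAt (T% X) x)
    (hY : MDiffAt (T% Y) x) : MDiffAt (metric X Y) x :=
  MDifferentiableAt.inner_bundle (E := fun x : M => TangentSpace I x) hX hY

lemma metric_smul_left (f : M → ℝ) (X Y : Π x : M, TangentSpace I x) :
    metric (f • X) Y = fun x => f x * metric X Y x := by
  funext x; simp [metric, inner_smul_left]
lemma metric_smul_right (f : M → ℝ) (X Y : Π x : M, TangentSpace I x) :
    metric X (f • Y) = fun x => f x * metric X Y x := by
  funext x; simp [metric, inner_smul_right]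
lemma metric_add_left (X X' Y : Π x : M, TangentSpace I x) :
    metric (X + X') Y = fun x => metric X Y x + metric X' Y x := by
  funext x; simp [metric, inner_add_left]
lemma metric_add_right (X Y Y' : Π x : M, TangentSpace I x) :
    metric X (Y + Y') = fun x => metric X Y x + metric X Y' x := by
  funext x; simp [metric, inner_add_right]

lemma koszul_tensorial₁ {x : M} {Y Z : Π x : M, TangentSpace I x} (hY : MDiffAt (T% Y) x)
    (hZ : MDiffAt (T% Z) x) : TensorialAt I E (fun X => koszul Y X Z x) x where
  smul {f X} hf hX := by
    simp only [koszul, dirDeriv, metric_smul_left, mvfderiv_fun_mul hf (metric_diff hX hZ),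
      mvfderiv_fun_mul hf (metric_diff hX hY), mlieBracket_smul_left hf hX]
    simp [metric, inner_add_left, inner_smul_left, inner_smul_right]
    ring
  add {X X'} hX hX' := by
    simp only [koszul, dirDeriv, metric_add_left,
      mvfderiv_fun_add (metric_diff hX hZ) (metric_diff hX' hZ),
      mvfderiv_fun_add (metric_diff hX hY) (metric_diff hX' hY), mlieBracket_add_left hX hX']
    simp [inner_add_left, inner_add_right]
    ring

lemma koszul_tensorial₂ {x : M} {Y X : Π x : M, TangentSpace I x} (hY : MDiffAt (T% Y) x)
    (hX : MDiffAt (T% X) x) : TensorialAt I E (fun Z => koszul Y X Z x) x where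
  smul {f Z} hf hZ := by
    simp only [koszul, dirDeriv, metric_smul_right, mvfderiv_fun_mul hf (metric_diff hX hZ),
      mvfderiv_fun_mul hf (metric_diff hY hZ), mlieBracket_smul_right hf hZ]
    simp [metric, inner_add_left, inner_smul_left, inner_smul_right, real_inner_comm (Z x)]
    ring
  add {Z Z'} hZ hZ' := by
    simp only [koszul, dirDeriv, metric_add_right,
      mvfderiv_fun_add (metric_diff hX hZ) (metric_diff hX hZ'),
      mvfderiv_fun_add (metric_diff hY hZ) (metric_diff hY hZ'), mlieBracket_add_right hZ hZ']
    simp [inner_add_left, inner_add_right]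
    ring

lemma koszul_smul {x : M} {f : M → ℝ} {Y X Z : Π x : M, TangentSpace I x} (hf : MDiffAt f x)
    (hY : MDiffAt (T% Y) x) (hX : MDiffAt (T% X) x) (hZ : MDiffAt (T% Z) x) :
    koszul (f • Y) X Z x = f x * koszul Y X Z x + mvfderiv I f x (X x) * inner ℝ (Y x) (Z x) := by
  simp only [koszul, dirDeriv, metric_smul_right, metric_smul_left,
    mvfderiv_fun_mul hf (metric_diff hY hZ),
      mvfderiv_fun_mul hf (metric_diff hX hY), mlieBracket_smul_right hf hY,
      mlieBracket_smul_left hf hY]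
  simp [metric, inner_add_left, inner_smul_left, inner_smul_right, real_inner_comm (X x) (Y x)]
  ring

lemma koszul_add {x : M} {Y Y' X Z : Π x : M, TangentSpace I x}
    (hY : MDiffAt (T% Y) x) (hY' : MDiffAt (T% Y') x)
    (hX : MDiffAt (T% X) x) (hZ : MDiffAt (T% Z) x) :
    koszul (Y + Y') X Z x = koszul Y X Z x + koszul Y' X Z x := by
  simp only [koszul, dirDeriv, metric_add_right, metric_add_left,
      mvfderiv_fun_add (metric_diff hY hZ) (metric_diff hY' hZ),
      mvfderiv_fun_add (metric_diff hX hY) (metric_diff hX hY'), mlieBracket_add_right hY hY',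
      mlieBracket_add_left hY hY']
  simp [inner_add_left, inner_add_right]
  ring

/-- The Koszul expression as a bilinear form in the values of `X` and `Z` at `x`. -/
def koszulForm {Y : Π x : M, TangentSpace I x} {x : M} (hY : MDiffAt (T% Y) x) :
    TangentSpace I x →L[ℝ] TangentSpace I x →L[ℝ] ℝ :=
  TensorialAt.mkHom₂ (fun X Z => koszul Y X Z x) x (fun _ hZ => koszul_tensorial₁ hY hZ)
    (fun _ hX => koszul_tensorial₂ hY hX)

lemma koszulForm_apply {Y X Z : Π x : M, TangentSpace I x} {x : M} (hY : MDiffAt (T% Y) x)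
    (hX : MDiffAt (T% X) x) (hZ : MDiffAt (T% Z) x) :
    koszulForm hY (X x) (Z x) = koszul Y X Z x :=
  TensorialAt.mkHom₂_apply _ _ hX hZ

instance (x : M) : FiniteDimensional ℝ (TangentSpace I x) := inferInstanceAs (FiniteDimensional ℝ E)

/-- The linear map `u ↦ ∇_u Y` at `x`, defined by the Koszul formula. -/
def leviCivitaFun {Y : Π x : M, TangentSpace I x} {x : M} (hY : MDiffAt (T% Y) x) :
    TangentSpace I x →L[ℝ] TangentSpace I x :=
  letI : CompleteSpace (TangentSpace I x) := FiniteDimensional.complete ℝ _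
  LinearMap.toContinuousLinearMap
    { toFun := fun u => (InnerProductSpace.toDual ℝ (TangentSpace I x)).symm (koszulForm hY u)
      map_add' := fun u v => by simp
      map_smul' := fun c u => by simp }

lemma inner_leviCivitaFun {Y : Π x : M, TangentSpace I x} {x : M} (hY : MDiffAt (T% Y) x)
    (u z : TangentSpace I x) : inner ℝ (leviCivitaFun hY u) z = koszulForm hY u z := by
  let _ : CompleteSpace (TangentSpace I x) := FiniteDimensional.complete ℝ _
  exact InnerProductSpace.toDual_symm_apply

open Classical in
/-- The Levi-Civita connection of the metric; in Mathlib's argument order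
`leviCivita Y x (X x)` is `(∇_X Y)(x)`. That it is torsion free and metric is proved below. -/
def leviCivita : CovariantDerivative I E (fun x : M => TangentSpace I x) where
  toFun Y x := if hY : MDiffAt (T% Y) x then leviCivitaFun hY else 0
  isCovariantDerivativeOnUniv :=
    { add := by
        intro Y Y' x hY hY' _
        have hs := mdifferentiableAt_add_section hY hY'
        rw [dif_pos hY, dif_pos hY', dif_pos hs]
        ext u
        refine ext_inner_right ℝ fun z => ?_
        have hu := mdifferentiableAt_extend I E u
        have hz := mdifferentiableAt_extend I E z
        have := koszul_add hY hY' hu hz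
        rw [← koszulForm_apply hs hu hz, ← koszulForm_apply hY hu hz,
          ← koszulForm_apply hY' hu hz] at this
        simpa [inner_add_left, inner_leviCivitaFun] using this
      leibniz := by
        intro Y f x hY hf _
        have hs := hf.smul_section hY
        rw [dif_pos hY, dif_pos hs]
        ext u
        refine ext_inner_right ℝ fun z => ?_
        have hu := mdifferentiableAt_extend I E u
        have hz := mdifferentiableAt_extend I E z
        have := koszul_smul hf hY hu hz
        rw [← koszulForm_apply hs hu hz, ← koszulForm_apply hY hu hz] at this
        simpa [inner_add_left, inner_smul_left, inner_leviCivitaFun] using this }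

lemma inner_leviCivita {X Y Z : Π x : M, TangentSpace I x} {x : M} (hX : MDiffAt (T% X) x)
    (hY : MDiffAt (T% Y) x) (hZ : MDiffAt (T% Z) x) :
    inner ℝ (leviCivita Y x (X x)) (Z x) = koszul Y X Z x := by
  rw [← koszulForm_apply hY hX hZ, ← inner_leviCivitaFun]
  simp [leviCivita, dif_pos hY]

theorem leviCivita_torsion : (leviCivita (I := I) (M := M)).torsion = 0 := by
  rw [CovariantDerivative.torsion_eq_zero_iff]
  intro X Y x hX hY
  refine ext_inner_right ℝ fun z => ?_
  have hz := mdifferentiableAt_extend I E z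
  have h1 := inner_leviCivita hX hY hz
  have h2 := inner_leviCivita hY hX hz
  rw [extend_apply_self] at h1 h2
  rw [inner_sub_left, h1, h2]
  have e : metric X Y = metric Y X := funext fun x => real_inner_comm _ _
  simp only [koszul, dirDeriv, e, mlieBracket_swap_apply (V := Y) (W := X)]
  simp
  ring

theorem leviCivita_metric {X Y Z : Π x : M, TangentSpace I x} {x : M} (hX : MDiffAt (T% X) x)
    (hY : MDiffAt (T% Y) x) (hZ : MDiffAt (T% Z) x) :
    dirDeriv X (metric Y Z) x
      = inner ℝ (leviCivita Y x (X x)) (Z x) + inner ℝ (Y x) (leviCivita Z x (X x)) := by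
  have h1 := inner_leviCivita hX hY hZ
  have h2 := inner_leviCivita hX hZ hY
  have e (A B : Π x : M, TangentSpace I x) : metric A B = metric B A :=
    funext fun x => real_inner_comm _ _
  rw [real_inner_comm] at h2
  rw [h1, h2]
  simp only [koszul, e Z Y, e X Z, mlieBracket_swap_apply (V := Z) (W := Y)]
  simp
  ring

/-- The curvature `R(X, Y)Z = ∇_X ∇_Y Z - ∇_Y ∇_X Z - ∇_[X,Y] Z`. -/
def curvature (X Y Z : Π x : M, TangentSpace I x) : Π x : M, TangentSpace I x := fun x =>
  leviCivita (fun y => leviCivita Z y (Y y)) x (X x)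
    - leviCivita (fun y => leviCivita Z y (X y)) x (Y x)
    - leviCivita Z x (mlieBracket I X Y x)

/-- `X` is a smooth vector field on `M`. -/
def IsSmoothField (X : Π x : M, TangentSpace I x) : Prop :=
  ContMDiff I (I.prod 𝓘(ℝ, E)) ∞ (fun x => TotalSpace.mk' E x (X x))

/-! ### Almost contact metric structures -/

variable (I M) in
/-- An almost contact metric structure `(φ, ξ, η, g)`, where `g` is the given Riemannian metric. -/
structure AlmostContactMetric where
  φ : Π x : M, TangentSpace I x →L[ℝ] TangentSpace I x
  ξ : Π x : M, TangentSpace I x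
  η : Π x : M, TangentSpace I x →L[ℝ] ℝ
  smooth_φ : ContMDiff I (I.prod 𝓘(ℝ, E →L[ℝ] E)) ∞
    (fun x => TotalSpace.mk' (E →L[ℝ] E)
      (E := fun x : M => TangentSpace I x →L[ℝ] TangentSpace I x) x (φ x))
  smooth_ξ : IsSmoothField ξ
  smooth_η : ContMDiff I (I.prod 𝓘(ℝ, E →L[ℝ] ℝ)) ∞
    (fun x => TotalSpace.mk' (E →L[ℝ] ℝ)
      (E := fun x : M => TangentSpace I x →L[ℝ] Bundle.Trivial M ℝ x) x (η x))
  η_ξ : ∀ x, η x (ξ x) = 1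
  φ_φ : ∀ x (u : TangentSpace I x), φ x (φ x u) = -u + η x u • ξ x
  inner_φ_φ : ∀ x (u v : TangentSpace I x),
    (inner ℝ (φ x u) (φ x v) : ℝ) = inner ℝ u v - η x u * η x v

namespace AlmostContactMetric

variable (S : AlmostContactMetric I M)

/-- The vector field `φX`. -/
def phi (X : Π x : M, TangentSpace I x) : Π x : M, TangentSpace I x := fun x => S.φ x (X x)

/-- The function `η(X)`. -/
def eta (X : Π x : M, TangentSpace I x) : M → ℝ := fun x => S.η x (X x)

/-- The exterior derivative of `η`, with the convention
`2 dη(X, Y) = X η(Y) - Y η(X) - η([X, Y])` that is customary in contact metric geometry. -/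
def dEta (X Y : Π x : M, TangentSpace I x) : M → ℝ := fun x =>
  (1 / 2 : ℝ) * (dirDeriv X (S.eta Y) x - dirDeriv Y (S.eta X) x - S.eta (mlieBracket I X Y) x)

/-- The contact metric condition `dη(X, Y) = g(X, φY)`. -/
def IsContactMetric : Prop :=
  ∀ X Y : Π x : M, TangentSpace I x, IsSmoothField X → IsSmoothField Y →
    S.dEta X Y = metric X (S.phi Y)

/-- The tensor `h = (1/2) L_ξ φ`, that is `2 hX = [ξ, φX] - φ[ξ, X]`. -/
def h (X : Π x : M, TangentSpace I x) : Π x : M, TangentSpace I x :=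
  (1 / 2 : ℝ) • (mlieBracket I S.ξ (S.phi X) - S.phi (mlieBracket I S.ξ X))

/-! The eight curvature-like tensors; all products are pointwise. -/

def R₁ (X Y Z : Π x : M, TangentSpace I x) : Π x : M, TangentSpace I x :=
  metric Y Z • X - metric X Z • Y

def R₂ (X Y Z : Π x : M, TangentSpace I x) : Π x : M, TangentSpace I x :=
  metric X (S.phi Z) • S.phi Y - metric Y (S.phi Z) • S.phi X
    + (2 : ℝ) • (metric X (S.phi Y) • S.phi Z)

def R₃ (X Y Z : Π x : M, TangentSpace I x) : Π x : M, TangentSpace I x :=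
  (S.eta X * S.eta Z) • Y - (S.eta Y * S.eta Z) • X
    + (metric X Z * S.eta Y) • S.ξ - (metric Y Z * S.eta X) • S.ξ

def R₄ (X Y Z : Π x : M, TangentSpace I x) : Π x : M, TangentSpace I x :=
  metric Y Z • S.h X - metric X Z • S.h Y + metric (S.h Y) Z • X - metric (S.h X) Z • Y

def R₅ (X Y Z : Π x : M, TangentSpace I x) : Π x : M, TangentSpace I x :=
  metric (S.h Y) Z • S.h X - metric (S.h X) Z • S.h Y
    + metric (S.phi (S.h X)) Z • S.phi (S.h Y) - metric (S.phi (S.h Y)) Z • S.phi (S.h X)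

def R₆ (X Y Z : Π x : M, TangentSpace I x) : Π x : M, TangentSpace I x :=
  (S.eta X * S.eta Z) • S.h Y - (S.eta Y * S.eta Z) • S.h X
    + (metric (S.h X) Z * S.eta Y) • S.ξ - (metric (S.h Y) Z * S.eta X) • S.ξ

def R₇ (X Y Z : Π x : M, TangentSpace I x) : Π x : M, TangentSpace I x :=
  metric Y Z • S.phi (S.h X) - metric X Z • S.phi (S.h Y)
    + metric (S.phi (S.h Y)) Z • X - metric (S.phi (S.h X)) Z • Y

def R₈ (X Y Z : Π x : M, TangentSpace I x) : Π x : M, TangentSpace I x :=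
  (S.eta X * S.eta Z) • S.phi (S.h Y) - (S.eta Y * S.eta Z) • S.phi (S.h X)
    + (metric (S.phi (S.h X)) Z * S.eta Y) • S.ξ - (metric (S.phi (S.h Y)) Z * S.eta X) • S.ξ

/-- `M(f₁, …, f₈)` is a generalized `(κ, μ, ν)`-space form: `R = f₁ R₁ + ⋯ + f₈ R₈`, where the
`fᵢ` are smooth functions. -/
structure IsGeneralizedSpaceForm (f₁ f₂ f₃ f₄ f₅ f₆ f₇ f₈ : M → ℝ) : Prop where
  smooth : ContMDiff I 𝓘(ℝ) ∞ f₁ ∧ ContMDiff I 𝓘(ℝ) ∞ f₂ ∧ ContMDiff I 𝓘(ℝ) ∞ f₃ ∧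
    ContMDiff I 𝓘(ℝ) ∞ f₄ ∧ ContMDiff I 𝓘(ℝ) ∞ f₅ ∧ ContMDiff I 𝓘(ℝ) ∞ f₆ ∧
    ContMDiff I 𝓘(ℝ) ∞ f₇ ∧ ContMDiff I 𝓘(ℝ) ∞ f₈
  curvature_eq : ∀ X Y Z : Π x : M, TangentSpace I x,
    IsSmoothField X → IsSmoothField Y → IsSmoothField Z →
      curvature X Y Z = f₁ • R₁ X Y Z + f₂ • S.R₂ X Y Z + f₃ • S.R₃ X Y Z + f₄ • S.R₄ X Y Z
        + f₅ • S.R₅ X Y Z + f₆ • S.R₆ X Y Z + f₇ • S.R₇ X Y Z + f₈ • S.R₈ X Y Z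

/-- The condition `R(X, Y)ξ = κ{η(Y)X - η(X)Y} + μ{η(Y)hX - η(X)hY} + ν{η(Y)φhX - η(X)φhY}`. -/
def KappaMuNuCondition (κ μ ν : M → ℝ) : Prop :=
  ∀ X Y : Π x : M, TangentSpace I x, IsSmoothField X → IsSmoothField Y →
    curvature X Y S.ξ = κ • (S.eta Y • X - S.eta X • Y) + μ • (S.eta Y • S.h X - S.eta X • S.h Y)
      + ν • (S.eta Y • S.phi (S.h X) - S.eta X • S.phi (S.h Y))

/-- `M` is a `(κ, μ)`-space, for constants `κ` and `μ`: it is contact metric and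
`R(X, Y)ξ = κ{η(Y)X - η(X)Y} + μ{η(Y)hX - η(X)hY}`. -/
def IsKappaMuSpace (κ μ : ℝ) : Prop :=
  S.IsContactMetric ∧
  ∀ X Y : Π x : M, TangentSpace I x, IsSmoothField X → IsSmoothField Y →
    curvature X Y S.ξ = κ • (S.eta Y • X - S.eta X • Y) + μ • (S.eta Y • S.h X - S.eta X • S.h Y)

/-- Every `φ`-section of `M` has sectional curvature `F`: `g(R(X, φX)φX, X) = F` at every point
at which `X` is a unit vector orthogonal to `ξ`. -/
def HasConstantPhiSectionalCurvature (F : ℝ) : Prop :=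
  ∀ X : Π x : M, TangentSpace I x, IsSmoothField X → ∀ x : M,
    inner ℝ (X x) (X x) = (1 : ℝ) → inner ℝ (X x) (S.ξ x) = (0 : ℝ) →
      metric (curvature X (S.phi X) (S.phi X)) X x = F

/-- The tensor `h` does not vanish identically. -/
def HNeZero : Prop :=
  ∃ X : Π x : M, TangentSpace I x, IsSmoothField X ∧ S.h X ≠ 0

end AlmostContactMetric

end ContactGeometry

end

open Bundle Manifold VectorField FiberBundle
open scoped ContDiff Topology

noncomputable section

namespace ContactGeometry

set_option linter.unusedSectionVars false

variable {E : Type*} [NormedAddCommGroup E] [NormedSpace ℝ E] [FiniteDimensional ℝ E]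
  [CompleteSpace E]
  {H : Type*} [TopologicalSpace H] {I : ModelWithCorners ℝ E H}
  {M : Type*} [TopologicalSpace M] [ChartedSpace H M] [IsManifold I ∞ M]
  [RiemannianBundle (fun x : M => TangentSpace I x)]
  [IsContMDiffRiemannianBundle I ∞ E (fun x : M => TangentSpace I x)]

/-! ### Smooth vector fields -/

/-! Write A = ∇ξ + φ (`shape`), so that h = φA and φh = -A. The contact condition makes A symmetric,
and dη being closed forces ∇_ξφ = 0 and Aφ = -φA. Evaluating the space form on ξ gives the (κ,μ,ν)
equation with κ = f₁ - f₃, μ = f₄ - f₆, ν = f₇ - f₈. The part of R(·,ξ)ξ commuting with φ says A² =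
1 - κ on the contact distribution (`shape_shape`).

Where κ < 1 the distribution splits into the eigenspaces of A for ±l, l² = 1 - κ, interchanged by φ.
Differentiating A² = 1 - κ, and using the Codazzi equation hidden in R(X,Y)ξ and the closedness of
g(·,φ·), expresses the horizontal parts of ∇φ and ∇A through dκ. Compatibility with Aφ = -φA then
kills dκ on eigenspaces of dimension at least two, which is where dimension at least 5 enters
(`FirstOrder.α_eq_zero_of_finrank`). Where κ = 1, its maximal possible value, dκ vanishes as well.
So dκ is a multiple of η, and non-integrability of the contact distribution makes it zero
(`mvfderiv_kappa`). Thus κ is constant, and κ < 1 because h ≠ 0.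

With dκ = 0 one gets ν = 0 and closed formulas for ∇φ and ∇A (`D_φ_eq`, `D_shape_eq`).
Differentiating these once more yields R(X,Y)ψ - ψR(X,Y) for ψ = φ, A, and comparison with the space
form on an orthonormal pair of eigenvectors and its φ-image (`EigPair.coefficients`) gives linear
equations determining every fᵢ in terms of κ. -/

lemma IsSmoothField.mdiffAt {X : Π x : M, TangentSpace I x} (hX : IsSmoothField X) (x : M) :
    MDiffAt (T% X) x :=
  (hX x).mdifferentiableAt (by simp)

lemma IsSmoothField.add {X Y : Π x : M, TangentSpace I x} (hX : IsSmoothField X)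
    (hY : IsSmoothField Y) : IsSmoothField (X + Y) :=
  ContMDiff.add_section hX hY

lemma IsSmoothField.sub {X Y : Π x : M, TangentSpace I x} (hX : IsSmoothField X)
    (hY : IsSmoothField Y) : IsSmoothField (X - Y) :=
  ContMDiff.sub_section hX hY

lemma IsSmoothField.smul {f : M → ℝ} {X : Π x : M, TangentSpace I x}
    (hf : ContMDiff I 𝓘(ℝ) ∞ f) (hX : IsSmoothField X) : IsSmoothField (f • X) :=
  ContMDiff.smul_section hf hX

lemma metric_smooth {X Y : Π x : M, TangentSpace I x} (hX : IsSmoothField X)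
    (hY : IsSmoothField Y) : ContMDiff I 𝓘(ℝ) ∞ (metric X Y) :=
  ContMDiff.inner_bundle (E := fun x : M => TangentSpace I x) hX hY

lemma mlieBracket_smooth {X Y : Π x : M, TangentSpace I x} (hX : IsSmoothField X)
    (hY : IsSmoothField Y) : IsSmoothField (mlieBracket I X Y) := by
  have : IsManifold I ((⊤ : ℕ∞) + 1) M := inferInstanceAs (IsManifold I ∞ M)
  have : IsManifold I (minSmoothness ℝ 2) M := IsManifold.of_le (n := ∞)
    (by rw [minSmoothness_of_isRCLikeNormedField]; exact ENat.LEInfty.out)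
  exact ContDiff.mlieBracket_vectorField (m := ⊤) (n := ⊤) hX hY (by simp)

lemma mdiffAt_of_smooth {f : M → ℝ} (hf : ContMDiff I 𝓘(ℝ) ∞ f) (x : M) : MDiffAt f x :=
  (hf x).mdifferentiableAt (by simp)

lemma dirDeriv_smooth {X : Π x : M, TangentSpace I x} {f : M → ℝ} (hX : IsSmoothField X)
    (hf : ContMDiff I 𝓘(ℝ) ∞ f) : ContMDiff I 𝓘(ℝ) ∞ (dirDeriv X f) := by
  have h1 : ContMDiff I.tangent 𝓘(ℝ, ℝ).tangent ∞ (tangentMap I 𝓘(ℝ, ℝ) f) :=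
    hf.contMDiff_tangentMap (by simp)
  have h2 := (contMDiff_snd_tangentBundle_modelSpace (n := ∞) ℝ 𝓘(ℝ, ℝ)).comp (h1.comp hX)
  exact h2

/-- Every tangent vector extends to a smooth vector field on the whole manifold. -/
lemma exists_smoothField [T2Space M] {x : M} (v : TangentSpace I x) :
    ∃ X : Π y : M, TangentSpace I y, IsSmoothField X ∧ X x = v := by
  obtain ⟨f⟩ : Nonempty (SmoothBumpFunction I x) := inferInstance
  refine ⟨(f : M → ℝ) • extend E v, ?_, ?_⟩
  · let t := trivializationAt E (TangentSpace I : M → Type _) x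
    have hf : ContMDiff I 𝓘(ℝ) ∞ f := f.contMDiff
    refine ContMDiffOn.smul_section_of_tsupport (u := t.baseSet) hf.contMDiffOn t.open_baseSet
      f.tsupport_subset_chartAt_source ?_
    intro y hy
    refine ContMDiffAt.contMDiffWithinAt ?_
    rw [t.contMDiffAt_section_iff hy]
    -- In the trivialization centred at x, `extend E v` is a constant section.
    have : (fun _ : M => (t ⟨x, v⟩).2) =ᶠ[𝓝 y] fun z => (t ⟨z, extend E v z⟩).2 := by
      filter_upwards [t.open_baseSet.mem_nhds hy] with z hz
      simp [extend, t, t.apply_mk_symm hz]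
    exact contMDiffAt_const.congr_of_eventuallyEq this.symm
  · simp

/-- A vector field is smooth if its inner products with smooth fields are smooth. -/
lemma isSmoothField_of_metric [T2Space M] {W : Π x : M, TangentSpace I x}
    (hW : ∀ Z : Π x : M, TangentSpace I x, IsSmoothField Z → ContMDiff I 𝓘(ℝ) ∞ (metric Z W)) :
    IsSmoothField W := by
  intro p
  let b : Module.Basis (Fin (Module.finrank ℝ E)) ℝ (TangentSpace I p) := Module.finBasis ℝ E
  choose Z hZ hZp using fun i => exists_smoothField (I := I) (b i)
  let G : M → Matrix (Fin (Module.finrank ℝ E)) (Fin (Module.finrank ℝ E)) ℝ :=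
    fun y => Matrix.gram ℝ (fun i => Z i y)
  have hG (i j) : ContMDiff I 𝓘(ℝ) ∞ fun y => G y i j := metric_smooth (hZ i) (hZ j)
  have hdet (A : M → Matrix (Fin (Module.finrank ℝ E)) (Fin (Module.finrank ℝ E)) ℝ)
      (hA : ∀ i j, ContMDiff I 𝓘(ℝ) ∞ fun y => A y i j) :
      ContMDiff I 𝓘(ℝ) ∞ fun y => (A y).det := by
    simp only [Matrix.det_apply]
    refine contMDiff_finsetSum fun σ _ => ?_
    have h := (contMDiff_const (I := I) (M := M) (n := ∞) (I' := 𝓘(ℝ))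
      (c := ((Equiv.Perm.sign σ : ℤ) : ℝ))).mul
        (contMDiff_finsetProd (t := Finset.univ) fun i _ => hA (σ i) i)
    refine h.congr fun y => ?_
    simp [Units.smul_def]
  have hp : (G p).det ≠ 0 := by
    rw [Matrix.det_gram_ne_zero_iff_linearIndependent]
    simpa [hZp] using b.linearIndependent
  -- Cramer's rule for the coefficients of W in the frame Z; they are smooth wherever the Gram
  -- determinant is nonzero, hence near p.
  let c : Fin (Module.finrank ℝ E) → M → ℝ := fun i y =>
    ((G y).det)⁻¹ * ((G y).updateCol i fun j => metric (Z j) W y).det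
  have hc (i) : ContMDiffAt I 𝓘(ℝ) ∞ (c i) p := by
    refine ContMDiffAt.mul ?_ (hdet _ ?_ p)
    · exact (hdet G hG p).inv₀ hp
    · intro k l
      by_cases h : l = i
      · subst h; simpa using hW _ (hZ k)
      · simpa [Matrix.updateCol_ne h] using hG k l
  have key : ∀ᶠ y in 𝓝 p, W y = ∑ i, c i y • Z i y := by
    filter_upwards [(hdet G hG p).continuousAt.eventually_ne hp] with y hy
    have hli := hy
    rw [Matrix.det_gram_ne_zero_iff_linearIndependent] at hli
    let B := Module.Basis.mk hli (hli.span_eq_top_of_card_eq_finrank'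
      (by simp only [Fintype.card_fin]; rfl)).ge
    have hB (i) : B i = Z i y := by simp [B]
    have h1 : (G y).mulVec (fun i => B.repr (W y) i) = fun j => metric (Z j) W y := by
      funext j
      conv_rhs => rw [metric, ← B.sum_repr (W y)]
      simp [Matrix.mulVec, dotProduct, G, Matrix.gram_apply, inner_sum, inner_smul_right, hB,
        mul_comm]
    have h2 (i) : c i y = B.repr (W y) i := by
      have h3 := Matrix.cramer_apply (G y) (fun j => metric (Z j) W y) i
      rw [Matrix.cramer_eq_adjugate_mulVec, ← h1, Matrix.mulVec_mulVec, Matrix.adjugate_mul,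
        Matrix.smul_mulVec, Matrix.one_mulVec, Pi.smul_apply, smul_eq_mul] at h3
      simp only [c]
      rw [← h1, ← h3, inv_mul_cancel_left₀ hy]
    conv_lhs => rw [← B.sum_repr (W y)]
    simp [h2, hB]
  have hsum : ContMDiffAt I (I.prod 𝓘(ℝ, E)) ∞
      (fun y => TotalSpace.mk' E y (∑ i, c i y • Z i y)) p :=
    ContMDiffAt.sum_section fun i _ => (hc i).smul_section (hZ i p)
  refine hsum.congr_of_eventuallyEq ?_
  filter_upwards [key] with y hy
  simp [hy]

/-! ### The Levi-Civita connection on smooth fields -/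

/-- The vector field `∇_X Y`. -/
def nabla (X Y : Π x : M, TangentSpace I x) : Π x : M, TangentSpace I x :=
  fun x => leviCivita Y x (X x)

/-- The Koszul formula writes each g(Z, ∇_X Y) through derivatives and brackets of smooth data. -/
lemma nabla_smooth [T2Space M] {X Y : Π x : M, TangentSpace I x} (hX : IsSmoothField X)
    (hY : IsSmoothField Y) : IsSmoothField (nabla X Y) := by
  refine isSmoothField_of_metric fun Z hZ => ?_
  have : metric Z (nabla X Y) = koszul Y X Z := by
    funext x
    rw [← inner_leviCivita (hX.mdiffAt x) (hY.mdiffAt x) (hZ.mdiffAt x)]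
    exact real_inner_comm _ _
  rw [this]
  refine contMDiff_const.mul ?_
  exact (((((dirDeriv_smooth hX (metric_smooth hY hZ)).add
    (dirDeriv_smooth hY (metric_smooth hX hZ))).sub
    (dirDeriv_smooth hZ (metric_smooth hX hY))).add
    (metric_smooth (mlieBracket_smooth hX hY) hZ)).sub
    (metric_smooth (mlieBracket_smooth hX hZ) hY)).sub
    (metric_smooth (mlieBracket_smooth hY hZ) hX)

lemma nabla_add {X Y Z : Π x : M, TangentSpace I x} (hY : IsSmoothField Y)
    (hZ : IsSmoothField Z) : nabla X (Y + Z) = nabla X Y + nabla X Z := by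
  funext x
  simp [nabla, leviCivita.isCovariantDerivativeOnUniv.add (hY.mdiffAt x) (hZ.mdiffAt x)]

lemma nabla_smul {f : M → ℝ} {X Y : Π x : M, TangentSpace I x} (hf : ContMDiff I 𝓘(ℝ) ∞ f)
    (hY : IsSmoothField Y) : nabla X (f • Y) = f • nabla X Y + dirDeriv X f • Y := by
  funext x
  simp [nabla, dirDeriv,
    leviCivita.isCovariantDerivativeOnUniv.leibniz (hY.mdiffAt x) (mdiffAt_of_smooth hf x)]

lemma nabla_sub {X Y Z : Π x : M, TangentSpace I x} (hY : IsSmoothField Y)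
    (hZ : IsSmoothField Z) : nabla X (Y - Z) = nabla X Y - nabla X Z := by
  have h := nabla_add (X := X) (hY.sub hZ) hZ
  rw [sub_add_cancel] at h
  rw [h, add_sub_cancel_right]

lemma dirDeriv_metric {X Y Z : Π x : M, TangentSpace I x} (hX : IsSmoothField X)
    (hY : IsSmoothField Y) (hZ : IsSmoothField Z) :
    dirDeriv X (metric Y Z) = metric (nabla X Y) Z + metric Y (nabla X Z) :=
  funext fun x => leviCivita_metric (hX.mdiffAt x) (hY.mdiffAt x) (hZ.mdiffAt x)

lemma mlieBracket_eq {X Y : Π x : M, TangentSpace I x} (hX : IsSmoothField X)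
    (hY : IsSmoothField Y) : mlieBracket I X Y = nabla X Y - nabla Y X :=
  funext fun x => ((CovariantDerivative.torsion_eq_zero_iff _).1 leviCivita_torsion
    (hX.mdiffAt x) (hY.mdiffAt x)).symm

lemma curvature_eq (X Y Z : Π x : M, TangentSpace I x) :
    curvature X Y Z = nabla X (nabla Y Z) - nabla Y (nabla X Z) - nabla (mlieBracket I X Y) Z :=
  rfl

lemma jacobi {X Y Z : Π x : M, TangentSpace I x} (hX : IsSmoothField X)
    (hY : IsSmoothField Y) (hZ : IsSmoothField Z) :
    mlieBracket I X (mlieBracket I Y Z) =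
      mlieBracket I (mlieBracket I X Y) Z + mlieBracket I Y (mlieBracket I X Z) := by
  have : IsManifold I (minSmoothness ℝ 3) M :=
    IsManifold.of_le (n := ∞) 
    (by rw [minSmoothness_of_isRCLikeNormedField]; exact ENat.LEInfty.out)
  have e : minSmoothness ℝ 2 ≤ (∞ : ℕ∞ω) := by
    rw [minSmoothness_of_isRCLikeNormedField]; exact ENat.LEInfty.out
  exact leibniz_identity_mlieBracket (ContMDiff.of_le hX e) (ContMDiff.of_le hY e)
    (ContMDiff.of_le hZ e)

/-- This is the Jacobi identity with brackets rewritten as [X,Y] = ∇_X Y - ∇_Y X. -/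
lemma first_bianchi [T2Space M] {X Y Z : Π x : M, TangentSpace I x} (hX : IsSmoothField X)
    (hY : IsSmoothField Y) (hZ : IsSmoothField Z) :
    curvature X Y Z + curvature Y Z X + curvature Z X Y = 0 := by
  have h := jacobi hX hY hZ
  rw [mlieBracket_eq hX (mlieBracket_smooth hY hZ),
    mlieBracket_eq (mlieBracket_smooth hX hY) hZ, mlieBracket_eq hY (mlieBracket_smooth hX hZ)] at h
  have hs : mlieBracket I X Z = - mlieBracket I Z X := mlieBracket_swap
  have hn : nabla (mlieBracket I X Z) Y = - nabla (mlieBracket I Z X) Y := by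
    rw [hs]; funext x; simp [nabla]
  rw [hn, mlieBracket_eq hX hZ, mlieBracket_eq hX hY, mlieBracket_eq hY hZ,
    nabla_sub (nabla_smooth hY hZ) (nabla_smooth hZ hY),
    nabla_sub (nabla_smooth hX hY) (nabla_smooth hY hX),
    nabla_sub (nabla_smooth hX hZ) (nabla_smooth hZ hX), ← mlieBracket_eq hX hY,
    ← mlieBracket_eq hY hZ] at h
  rw [curvature_eq, curvature_eq, curvature_eq]
  rw [← sub_eq_zero] at h
  rw [← h]
  abel

lemma dirDeriv_mul {X : Π x : M, TangentSpace I x} {f g : M → ℝ} (hf : ContMDiff I 𝓘(ℝ) ∞ f)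
    (hg : ContMDiff I 𝓘(ℝ) ∞ g) : dirDeriv X (f * g) = f * dirDeriv X g + g * dirDeriv X f := by
  funext x
  simp [dirDeriv, mvfderiv_mul (mdiffAt_of_smooth hf x) (mdiffAt_of_smooth hg x)]

lemma mlieBracket_smul {f : M → ℝ} {X Y : Π x : M, TangentSpace I x}
    (hf : ContMDiff I 𝓘(ℝ) ∞ f) (hY : IsSmoothField Y) :
    mlieBracket I X (f • Y) = dirDeriv X f • Y + f • mlieBracket I X Y := by
  funext x
  simp [mlieBracket_smul_right (mdiffAt_of_smooth hf x) (hY.mdiffAt x), dirDeriv]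

lemma mlieBracket_add {X Y Z : Π x : M, TangentSpace I x} (hY : IsSmoothField Y)
    (hZ : IsSmoothField Z) :
    mlieBracket I X (Y + Z) = mlieBracket I X Y + mlieBracket I X Z := by
  funext x
  simp [mlieBracket_add_right (hY.mdiffAt x) (hZ.mdiffAt x)]

/-- The Lie bracket acts on functions as the commutator of derivations. -/
lemma dirDeriv_mlieBracket {f : M → ℝ} {X Y Z : Π x : M, TangentSpace I x}
    (hX : IsSmoothField X) (hY : IsSmoothField Y) (hZ : IsSmoothField Z)
    (hf : ContMDiff I 𝓘(ℝ) ∞ f) :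
    dirDeriv (mlieBracket I X Y) f • Z
      = dirDeriv X (dirDeriv Y f) • Z - dirDeriv Y (dirDeriv X f) • Z := by
  -- Expanding the Jacobi identity for X, Y, fZ by the Leibniz rule and removing f times the one for
  -- X, Y, Z leaves only the second derivatives of f.
  have h1 := jacobi hX hY (hZ.smul hf)
  have h2 := jacobi hX hY hZ
  have dX := dirDeriv_smooth hX hf
  have dY := dirDeriv_smooth hY hf
  have bX := mlieBracket_smooth hX hZ
  have bY := mlieBracket_smooth hY hZ
  rw [mlieBracket_smul hf hZ, mlieBracket_smul hf hZ, mlieBracket_smul hf hZ,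
    mlieBracket_add (hZ.smul dY) (bY.smul hf), mlieBracket_add (hZ.smul dX) (bX.smul hf),
    mlieBracket_smul dY hZ, mlieBracket_smul dX hZ, mlieBracket_smul hf bX,
    mlieBracket_smul hf bY, h2] at h1
  rw [← sub_eq_zero] at h1 ⊢
  rw [← neg_eq_zero, ← h1, smul_add]
  abel

lemma nabla_zero (X : Π x : M, TangentSpace I x) : nabla X 0 = 0 := by
  funext x; simp [nabla]

lemma dirDeriv_add {X : Π x : M, TangentSpace I x} {f g : M → ℝ} (hf : ContMDiff I 𝓘(ℝ) ∞ f)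
    (hg : ContMDiff I 𝓘(ℝ) ∞ g) : dirDeriv X (f + g) = dirDeriv X f + dirDeriv X g := by
  funext x
  simp [dirDeriv, mvfderiv_add (mdiffAt_of_smooth hf x) (mdiffAt_of_smooth hg x)]

/-! ### Endomorphism fields and their covariant derivatives -/

variable (I M) in
/-- A smooth field of endomorphisms which are all symmetric (`sign = 1`) or all skew-symmetric
(`sign = -1`). -/
structure EndField where
  toFun : Π x : M, TangentSpace I x →L[ℝ] TangentSpace I x
  smooth : ∀ X : Π x : M, TangentSpace I x, IsSmoothField X →
    IsSmoothField (fun x => toFun x (X x))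
  sign : ℝ
  inner_left : ∀ x (u v : TangentSpace I x),
    (inner ℝ (toFun x u) v : ℝ) = sign * inner ℝ u (toFun x v)

namespace EndField

variable (ψ : EndField I M)

/-- The vector field `ψX`. -/
def app (X : Π x : M, TangentSpace I x) : Π x : M, TangentSpace I x := fun x => ψ.toFun x (X x)

/-- The vector field `(∇_X ψ)Y`. -/
def nablaApp (X Y : Π x : M, TangentSpace I x) : Π x : M, TangentSpace I x :=
  nabla X (ψ.app Y) - ψ.app (nabla X Y)

variable {ψ}

lemma app_smooth {Y : Π x : M, TangentSpace I x} (hY : IsSmoothField Y) :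
    IsSmoothField (ψ.app Y) :=
  ψ.smooth Y hY

/-- Differentiate g(ψY, Z) = `sign` · g(Y, ψZ) along X. -/
lemma inner_nablaApp {X Y Z : Π x : M, TangentSpace I x} (hX : IsSmoothField X)
    (hY : IsSmoothField Y) (hZ : IsSmoothField Z) (x : M) :
    inner ℝ (ψ.nablaApp X Y x) (Z x) = ψ.sign * inner ℝ (Y x) (ψ.nablaApp X Z x) := by
  have h1 := congrFun (dirDeriv_metric hX (ψ.app_smooth hY) hZ) x
  have h2 := congrFun (dirDeriv_metric hX hY (ψ.app_smooth hZ)) x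
  have e : metric (ψ.app Y) Z = fun x => ψ.sign * metric Y (ψ.app Z) x := by
    funext y; exact ψ.inner_left y _ _
  have h3 : dirDeriv X (fun x => ψ.sign * metric Y (ψ.app Z) x) x
      = ψ.sign * dirDeriv X (metric Y (ψ.app Z)) x := by
    have := congrFun (dirDeriv_mul (X := X) (contMDiff_const (c := ψ.sign))
      (metric_smooth hY (ψ.app_smooth hZ))) x
    simpa [dirDeriv, mvfderiv_const, Pi.mul_def] using this
  rw [e, h3, h2] at h1
  have h4 := ψ.inner_left x (nabla X Y x) (Z x)
  have h5 := ψ.inner_left x (Y x) (nabla X Z x)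
  simp only [nablaApp, metric, Pi.add_apply, Pi.sub_apply, inner_sub_left, inner_sub_right,
    app] at h1 h4 h5 ⊢
  change _ = inner ℝ (nabla X (ψ.app Y) x) (Z x) + _ at h1
  change _ = _ * (_ - _)
  linear_combination -h1 - h4 - h5

variable [T2Space M]

/-- Dependence on X at x alone is clear. For Y, the adjointness relation moves Y out of the
derivative, where only its value at x is seen; this is why `EndField` carries a sign. -/
lemma nablaApp_congr {X Y X' Y' : Π x : M, TangentSpace I x} (hX : IsSmoothField X)
    (hY : IsSmoothField Y) (hY' : IsSmoothField Y') {x : M}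
    (h : X x = X' x) (h' : Y x = Y' x) : ψ.nablaApp X Y x = ψ.nablaApp X' Y' x := by
  have h1 : ψ.nablaApp X' Y' x = ψ.nablaApp X Y' x := by
    simp [nablaApp, nabla, app, h]
  rw [h1]
  refine ext_inner_right ℝ fun w => ?_
  obtain ⟨W, hW, rfl⟩ := exists_smoothField (I := I) w
  rw [inner_nablaApp hX hY hW, inner_nablaApp hX hY' hW, h']

variable (ψ) in
/-- The covariant derivative of an endomorphism field at a point: `ψ.D x u v = (∇_u ψ)v`. -/
def D (x : M) : TangentSpace I x →ₗ[ℝ] TangentSpace I x →ₗ[ℝ] TangentSpace I x :=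
  LinearMap.mk₂ ℝ
    (fun u v => ψ.nablaApp (exists_smoothField (I := I) u).choose
      (exists_smoothField (I := I) v).choose x)
    (fun u u' v => by
      simp only [nablaApp, nabla, app, Pi.sub_apply,
        (exists_smoothField (I := I) u).choose_spec.2,
        (exists_smoothField (I := I) u').choose_spec.2,
        (exists_smoothField (I := I) (u + u')).choose_spec.2, map_add]
      abel)
    (fun c u v => by
      simp only [nablaApp, nabla, app, Pi.sub_apply,
        (exists_smoothField (I := I) u).choose_spec.2,
        (exists_smoothField (I := I) (c • u)).choose_spec.2, map_smul, smul_sub])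
    (fun u v v' => by
      have hu := (exists_smoothField (I := I) u).choose_spec.1
      obtain ⟨hv, ev⟩ := (exists_smoothField (I := I) v).choose_spec
      obtain ⟨hv', ev'⟩ := (exists_smoothField (I := I) v').choose_spec
      obtain ⟨hw, ew⟩ := (exists_smoothField (I := I) (v + v')).choose_spec
      -- The chosen extension of v + v' may be traded for the sum of the chosen extensions.
      rw [nablaApp_congr hu hw (hv.add hv') rfl (by simp [ev, ev', ew])]
      have : ∀ Y Y' : Π x : M, TangentSpace I x, ψ.app (Y + Y') = ψ.app Y + ψ.app Y' :=
        fun Y Y' => by funext y; simp [app]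
      rw [nablaApp, this, nabla_add (ψ.app_smooth hv) (ψ.app_smooth hv'), nabla_add hv hv', this]
      simp only [nablaApp, Pi.sub_apply, Pi.add_apply]
      abel)
    (fun c u v => by
      have hu := (exists_smoothField (I := I) u).choose_spec.1
      obtain ⟨hv, ev⟩ := (exists_smoothField (I := I) v).choose_spec
      obtain ⟨hw, ew⟩ := (exists_smoothField (I := I) (c • v)).choose_spec
      refine ext_inner_right ℝ fun w => ?_
      obtain ⟨W, hW, rfl⟩ := exists_smoothField (I := I) w
      rw [inner_smul_left, inner_nablaApp hu hw hW, inner_nablaApp hu hv hW, ew, ev,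
        inner_smul_left]
      simp; ring)

lemma nablaApp_apply {X Y : Π x : M, TangentSpace I x} (hX : IsSmoothField X)
    (hY : IsSmoothField Y) (x : M) : ψ.nablaApp X Y x = ψ.D x (X x) (Y x) := by
  obtain ⟨hu, eu⟩ := (exists_smoothField (I := I) (X x)).choose_spec
  obtain ⟨hv, ev⟩ := (exists_smoothField (I := I) (Y x)).choose_spec
  exact nablaApp_congr hX hY hv eu.symm ev.symm

lemma nabla_app {X Y : Π x : M, TangentSpace I x} (hX : IsSmoothField X)
    (hY : IsSmoothField Y) (x : M) :
    nabla X (ψ.app Y) x = ψ.D x (X x) (Y x) + ψ.toFun x (nabla X Y x) := by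
  rw [← nablaApp_apply hX hY, nablaApp]
  simp [app]

lemma inner_D (x : M) (u v w : TangentSpace I x) :
    inner ℝ (ψ.D x u v) w = ψ.sign * inner ℝ v (ψ.D x u w) := by
  obtain ⟨U, hU, rfl⟩ := exists_smoothField (I := I) u
  obtain ⟨V, hV, rfl⟩ := exists_smoothField (I := I) v
  obtain ⟨W, hW, rfl⟩ := exists_smoothField (I := I) w
  rw [← nablaApp_apply hU hV, ← nablaApp_apply hU hW, inner_nablaApp hU hV hW]

end EndField

/-! ### Contact metric structures -/

namespace AlmostContactMetric

variable {S : AlmostContactMetric I M}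

section algebra

variable {x : M}

lemma φ_ξ : S.φ x (S.ξ x) = 0 := by
  have h1 := S.φ_φ x (S.ξ x)
  rw [S.η_ξ, one_smul, neg_add_cancel] at h1
  have h2 := S.φ_φ x (S.φ x (S.ξ x))
  rw [h1, map_zero] at h2
  have h3 := congrArg (S.φ x) h2
  rw [map_zero, map_add, map_neg, h1, map_smul, neg_zero, zero_add] at h3
  rcases smul_eq_zero.1 h3.symm with h | h
  · rw [h] at h2; simpa using h2.symm
  · exact h

lemma η_eq (u : TangentSpace I x) : S.η x u = inner ℝ (S.ξ x) u := by
  have h := S.inner_φ_φ x u (S.ξ x)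
  rw [φ_ξ, inner_zero_right, S.η_ξ, mul_one, real_inner_comm] at h
  linarith

lemma inner_ξ_ξ : inner ℝ (S.ξ x) (S.ξ x) = (1 : ℝ) := by rw [← η_eq, S.η_ξ]

lemma φ_φ_eq (u : TangentSpace I x) :
    S.φ x (S.φ x u) = -u + (inner ℝ (S.ξ x) u : ℝ) • S.ξ x := by
  rw [S.φ_φ, η_eq]

lemma inner_ξ_φ (u : TangentSpace I x) : inner ℝ (S.ξ x) (S.φ x u) = (0 : ℝ) := by
  have h1 := S.φ_φ x (S.φ x u)
  rw [S.φ_φ x u, map_add, map_neg, map_smul, φ_ξ, smul_zero, add_zero] at h1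
  have h2 : S.η x (S.φ x u) • S.ξ x = 0 := by simpa using h1.symm
  have h3 := congrArg (S.η x) h2
  rw [map_smul, S.η_ξ, map_zero] at h3
  rw [← η_eq]
  simpa using h3

lemma inner_φ_left (u v : TangentSpace I x) :
    (inner ℝ (S.φ x u) v : ℝ) = -inner ℝ u (S.φ x v) := by
  have h := S.inner_φ_φ x u (S.φ x v)
  rw [φ_φ_eq, η_eq, η_eq, inner_ξ_φ, inner_add_right, inner_neg_right, inner_smul_right,
    real_inner_comm (S.ξ x), inner_ξ_φ] at h
  linarith

end algebra

lemma phi_smooth {X : Π x : M, TangentSpace I x} (hX : IsSmoothField X) :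
    IsSmoothField (S.phi X) :=
  ContMDiff.clm_bundle_apply S.smooth_φ hX

variable (S) in
/-- `φ` as an endomorphism field. -/
def phiEnd : EndField I M where
  toFun := S.φ
  smooth _ hX := phi_smooth hX
  sign := -1
  inner_left x u v := by rw [inner_φ_left]; ring

lemma phiEnd_toFun : S.phiEnd.toFun = S.φ := rfl

lemma eta_eq_metric (X : Π x : M, TangentSpace I x) : S.eta X = metric S.ξ X :=
  funext fun _ => η_eq _

/-- The symmetric part `∇ξ + φ` of the covariant derivative of `ξ`. -/
def shape (S : AlmostContactMetric I M) (x : M) : TangentSpace I x →L[ℝ] TangentSpace I x :=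
  leviCivita S.ξ x + S.φ x

lemma nabla_ξ (X : Π x : M, TangentSpace I x) (x : M) :
    nabla X S.ξ x = S.shape x (X x) - S.φ x (X x) := by
  simp [nabla, shape]

variable [T2Space M]

/-- Since 2dη(X,Y) = g(∇_X ξ, Y) - g(∇_Y ξ, X), the contact condition says that the skew part of ∇ξ
is -φ. -/
lemma inner_shape_left (hS : S.IsContactMetric) (x : M) (u v : TangentSpace I x) :
    (inner ℝ (S.shape x u) v : ℝ) = inner ℝ u (S.shape x v) := by
  obtain ⟨X, hX, rfl⟩ := exists_smoothField (I := I) u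
  obtain ⟨Y, hY, rfl⟩ := exists_smoothField (I := I) v
  have h := congrFun (hS X Y hX hY) x
  have hξ := S.smooth_ξ
  have h1 := congrFun (dirDeriv_metric hX hξ hY) x
  have h2 := congrFun (dirDeriv_metric hY hξ hX) x
  have h3 := inner_φ_left (S := S) (X x) (Y x)
  simp only [dEta, eta_eq_metric] at h
  rw [h1, h2, mlieBracket_eq hX hY] at h
  simp only [metric, Pi.add_apply, nabla_ξ, inner_sub_left, Pi.sub_apply, inner_sub_right,
    phi] at h
  linarith [real_inner_comm (X x) (S.shape x (Y x)), real_inner_comm (X x) (S.φ x (Y x))]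

lemma inner_ξ_shape_sub (x : M) (u : TangentSpace I x) :
    (inner ℝ (S.ξ x) (S.shape x u) : ℝ) = 0 := by
  obtain ⟨X, hX, rfl⟩ := exists_smoothField (I := I) u
  have h1 := congrFun (dirDeriv_metric hX S.smooth_ξ S.smooth_ξ) x
  have h2 : metric S.ξ S.ξ = fun _ => 1 := funext fun _ => inner_ξ_ξ
  rw [h2] at h1
  simp only [dirDeriv, mvfderiv_const, metric, Pi.add_apply, nabla_ξ,
    inner_sub_right, inner_ξ_φ, real_inner_comm (S.ξ x), zero_apply] at h1
  linarith

lemma shape_ξ (hS : S.IsContactMetric) (x : M) : S.shape x (S.ξ x) = 0 := by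
  refine ext_inner_right ℝ fun w => ?_
  rw [inner_shape_left hS, inner_ξ_shape_sub, inner_zero_left]

lemma nabla_ξ_smooth {X : Π x : M, TangentSpace I x} (hX : IsSmoothField X) :
    IsSmoothField (fun x => S.shape x (X x)) := by
  have h := (nabla_smooth hX S.smooth_ξ).add (phi_smooth (S := S) hX)
  have e : (fun x => S.shape x (X x)) = nabla X S.ξ + S.phi X := by
    funext x; simp [nabla_ξ, phi]
  rwa [e]

/-- `∇ξ + φ` as an endomorphism field. -/
def shapeEnd (hS : S.IsContactMetric) : EndField I M where
  toFun := S.shape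
  smooth _ hX := nabla_ξ_smooth hX
  sign := 1
  inner_left x u v := by rw [inner_shape_left hS, one_mul]

lemma shapeEnd_toFun (hS : S.IsContactMetric) : (shapeEnd hS).toFun = S.shape := rfl

/-- The curvature `R(X, Y)ξ` in terms of the covariant derivatives of `φ` and `∇ξ + φ`. -/
lemma curvature_ξ (hS : S.IsContactMetric) {X Y : Π x : M, TangentSpace I x}
    (hX : IsSmoothField X) (hY : IsSmoothField Y) (x : M) :
    curvature X Y S.ξ x = (shapeEnd hS).D x (X x) (Y x) - (shapeEnd hS).D x (Y x) (X x)
      - S.phiEnd.D x (X x) (Y x) + S.phiEnd.D x (Y x) (X x) := by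
  have e (Z : Π x : M, TangentSpace I x) :
      nabla Z S.ξ = (shapeEnd hS).app Z - S.phiEnd.app Z := by
    funext y; simp [nabla_ξ, EndField.app, shapeEnd, phiEnd]
  rw [curvature_eq, mlieBracket_eq hX hY, e Y, e X, e (nabla X Y - nabla Y X),
    nabla_sub ((shapeEnd hS).app_smooth hY) (S.phiEnd.app_smooth hY),
    nabla_sub ((shapeEnd hS).app_smooth hX) (S.phiEnd.app_smooth hX)]
  simp only [Pi.sub_apply, EndField.nabla_app hX hY, EndField.nabla_app hY hX]
  simp only [EndField.app, Pi.sub_apply, map_sub]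
  abel

section derivatives

variable {x : M} (u v w : TangentSpace I x)

lemma inner_D_φ :
    (inner ℝ (S.phiEnd.D x u v) w : ℝ) = -inner ℝ v (S.phiEnd.D x u w) := by
  rw [EndField.inner_D]; simp [phiEnd]

lemma inner_D_shape (hS : S.IsContactMetric) :
    (inner ℝ ((shapeEnd hS).D x u v) w : ℝ) = inner ℝ v ((shapeEnd hS).D x u w) := by
  rw [EndField.inner_D]; simp [shapeEnd]

end derivatives

/-- Pairing with the unit field ξ strips the auxiliary field from `dirDeriv_mlieBracket`. -/
lemma dirDeriv_comm (S : AlmostContactMetric I M) {f : M → ℝ} {X Y : Π x : M, TangentSpace I x}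
    (hX : IsSmoothField X) (hY : IsSmoothField Y) (hf : ContMDiff I 𝓘(ℝ) ∞ f) :
    dirDeriv (mlieBracket I X Y) f = dirDeriv X (dirDeriv Y f) - dirDeriv Y (dirDeriv X f) := by
  funext x
  have h := congrArg (fun v => (inner ℝ (S.ξ x) v : ℝ))
    (congrFun (dirDeriv_mlieBracket hX hY S.smooth_ξ hf) x)
  simpa [inner_sub_right, inner_smul_right, inner_ξ_ξ, -inner_self_eq_norm_sq_to_K] using h

/-- Apply [X,Y] = XY - YX to the function g(Z, W) and expand by metric compatibility. -/
lemma curvature_skew (S : AlmostContactMetric I M) {X Y Z W : Π x : M, TangentSpace I x}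
    (hX : IsSmoothField X) (hY : IsSmoothField Y) (hZ : IsSmoothField Z) (hW : IsSmoothField W)
    (x : M) : (inner ℝ (curvature X Y Z x) (W x) : ℝ) = -inner ℝ (Z x) (curvature X Y W x) := by
  have h := congrFun (dirDeriv_comm S hX hY (metric_smooth hZ hW)) x
  have nXZ := nabla_smooth hX hZ
  have nYZ := nabla_smooth hY hZ
  have nXW := nabla_smooth hX hW
  have nYW := nabla_smooth hY hW
  rw [dirDeriv_metric (mlieBracket_smooth hX hY) hZ hW, dirDeriv_metric hX hZ hW,
    dirDeriv_metric hY hZ hW, Pi.sub_apply,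
    dirDeriv_add (metric_smooth nXZ hW) (metric_smooth hZ nXW),
    dirDeriv_add (metric_smooth nYZ hW) (metric_smooth hZ nYW),
    dirDeriv_metric hX nYZ hW, dirDeriv_metric hX hZ nYW,
    dirDeriv_metric hY nXZ hW, dirDeriv_metric hY hZ nXW] at h
  simp only [metric, Pi.add_apply, curvature_eq, Pi.sub_apply, inner_sub_left,
    inner_sub_right] at h ⊢
  linarith

section derivatives

variable {x : M} (u v w : TangentSpace I x)

/-- The fundamental 2-form of a contact metric structure is closed. -/
lemma D_φ_cyclic (hS : S.IsContactMetric) :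
    (inner ℝ (S.phiEnd.D x u v) w : ℝ) + inner ℝ (S.phiEnd.D x v w) u
      + inner ℝ (S.phiEnd.D x w u) v = 0 := by
  obtain ⟨X, hX, rfl⟩ := exists_smoothField (I := I) u
  obtain ⟨Y, hY, rfl⟩ := exists_smoothField (I := I) v
  obtain ⟨Z, hZ, rfl⟩ := exists_smoothField (I := I) w
  -- In the ξ-component of the Bianchi identity the derivatives of A cancel by symmetry, while those
  -- of the skew φ add up to twice the cyclic sum.
  have h := congrArg (fun v => (inner ℝ v (S.ξ x) : ℝ)) (congrFun (first_bianchi hX hY hZ) x)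
  simp only [Pi.add_apply, Pi.zero_apply, inner_add_left, inner_zero_left] at h
  rw [curvature_skew S hX hY hZ S.smooth_ξ, curvature_skew S hY hZ hX S.smooth_ξ,
    curvature_skew S hZ hX hY S.smooth_ξ, curvature_ξ hS hX hY, curvature_ξ hS hY hZ,
    curvature_ξ hS hZ hX] at h
  simp only [inner_add_right, inner_sub_right] at h
  have s1 := inner_D_shape (X x) (Y x) (Z x) hS
  have s2 := inner_D_shape (Y x) (Z x) (X x) hS
  have s3 := inner_D_shape (Z x) (X x) (Y x) hS
  have t1 := inner_D_φ (S := S) (X x) (Y x) (Z x)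
  have t2 := inner_D_φ (S := S) (Y x) (Z x) (X x)
  have t3 := inner_D_φ (S := S) (Z x) (X x) (Y x)
  simp only [real_inner_comm _ (X x), real_inner_comm _ (Y x), real_inner_comm _ (Z x)] at *
  linarith

lemma D_φ_ξ_right : S.phiEnd.D x u (S.ξ x) = -S.φ x (S.shape x u - S.φ x u) := by
  obtain ⟨X, hX, rfl⟩ := exists_smoothField (I := I) u
  rw [← EndField.nablaApp_apply hX S.smooth_ξ, EndField.nablaApp]
  have : S.phiEnd.app S.ξ = 0 := by
    funext y; simp [EndField.app, phiEnd, φ_ξ]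
  rw [this, nabla_zero]
  simp [EndField.app, phiEnd, nabla_ξ]

lemma D_shape_ξ_right (hS : S.IsContactMetric) :
    (shapeEnd hS).D x u (S.ξ x) = -S.shape x (S.shape x u - S.φ x u) := by
  obtain ⟨X, hX, rfl⟩ := exists_smoothField (I := I) u
  rw [← EndField.nablaApp_apply hX S.smooth_ξ, EndField.nablaApp]
  have : (shapeEnd hS).app S.ξ = 0 := by
    funext y; simp [EndField.app, shapeEnd, shape_ξ hS]
  rw [this, nabla_zero]
  simp [EndField.app, shapeEnd, nabla_ξ]

/-- The derivative of φ² = -1 + η ⊗ ξ, with ∇ξ = A - φ. -/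
lemma D_φ_φ : S.phiEnd.D x u (S.φ x v) + S.φ x (S.phiEnd.D x u v) =
    (inner ℝ (S.shape x u - S.φ x u) v : ℝ) • S.ξ x
      + (inner ℝ (S.ξ x) v : ℝ) • (S.shape x u - S.φ x u) := by
  obtain ⟨X, hX, rfl⟩ := exists_smoothField (I := I) u
  obtain ⟨Y, hY, rfl⟩ := exists_smoothField (I := I) v
  have h1 := EndField.nabla_app (ψ := S.phiEnd) hX (S.phiEnd.app_smooth hY) x
  have h2 := EndField.nabla_app (ψ := S.phiEnd) hX hY x
  have e : S.phiEnd.app (S.phiEnd.app Y) = metric S.ξ Y • S.ξ - Y := by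
    funext y
    simp only [EndField.app, phiEnd, φ_φ_eq, Pi.sub_apply, Pi.smul_apply', metric]
    abel
  have h3 := congrFun (nabla_smul (X := X) (metric_smooth S.smooth_ξ hY) S.smooth_ξ) x
  have h4 := congrFun (dirDeriv_metric hX S.smooth_ξ hY) x
  change nabla X (S.phiEnd.app (S.phiEnd.app Y)) x = _ at h1
  change nabla X (S.phiEnd.app Y) x = _ at h2
  rw [e, nabla_sub (S.smooth_ξ.smul (metric_smooth S.smooth_ξ hY)) hY, Pi.sub_apply, h3] at h1
  change _ = _ + S.phiEnd.toFun x (nabla X (S.phiEnd.app Y) x) at h1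
  rw [h2, Pi.add_apply, Pi.smul_apply', Pi.smul_apply', h4] at h1
  simp only [EndField.app, phiEnd_toFun, map_add, φ_φ_eq, metric, Pi.add_apply, nabla_ξ,
    add_smul] at h1 ⊢
  linear_combination (norm := module) (-1 : ℝ) • h1

/-- The cyclic identity with ξ in one slot expresses ∇_ξφ through (∇φ)ξ, which is known from φξ = 0.
-/
lemma D_φ_ξ_left_aux (hS : S.IsContactMetric) :
    S.phiEnd.D x (S.ξ x) v = -(S.shape x (S.φ x v) + S.φ x (S.shape x v)) := by
  refine ext_inner_right ℝ fun w => ?_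
  have h1 := D_φ_cyclic (S.ξ x) v w hS
  have h2 := inner_D_φ (S := S) v w (S.ξ x)
  rw [D_φ_ξ_right] at h1 h2
  have h3 := inner_φ_left (S := S) v (S.φ x w)
  have h4 := inner_φ_left (S := S) w (S.φ x v)
  have h5 := inner_φ_left (S := S) (S.shape x w) v
  have h6 := inner_shape_left hS x w (S.φ x v)
  simp only [map_sub, inner_neg_right, inner_neg_left, inner_sub_right, inner_sub_left,
    inner_add_left] at *
  have e := fun a b : TangentSpace I x => real_inner_comm a b
  rw [inner_φ_left (S := S) (S.φ x w) v, inner_φ_left (S := S) w (S.φ x v)] at h1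
  linarith [e w (S.shape x (S.φ x v)), e w (S.φ x (S.shape x v)), e w (S.φ x (S.φ x v)),
    inner_φ_left (S := S) (S.shape x w) v]

/-- `∇ξ + φ` anticommutes with `φ`. -/
lemma shape_φ (hS : S.IsContactMetric) : S.shape x (S.φ x v) = -S.φ x (S.shape x v) := by
  -- As ∇_ξξ = 0, the operator ∇_ξφ = -(Aφ + φA) anticommutes with φ. This amounts to φAφ = A, and
  -- applying φ gives Aφ = -φA.
  have h1 := D_φ_φ (S := S) (S.ξ x) v
  rw [shape_ξ hS, φ_ξ, D_φ_ξ_left_aux _ hS, D_φ_ξ_left_aux _ hS, φ_φ_eq] at h1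
  simp only [map_add, map_neg, map_smul, shape_ξ hS, φ_φ_eq, inner_ξ_shape_sub, sub_zero,
    inner_zero_left, zero_smul, smul_zero, add_zero] at h1
  have h2 := congrArg (S.φ x) h1
  simp only [map_add, map_neg, map_zero, φ_φ_eq, inner_ξ_shape_sub, zero_smul, add_zero] at h2
  have h3 : (2 : ℝ) • (S.shape x (S.φ x v) + S.φ x (S.shape x v)) = 0 := by
    linear_combination (norm := module) h2
  have h4 := (smul_eq_zero.1 h3).resolve_left two_ne_zero
  exact eq_neg_of_add_eq_zero_left h4

lemma D_φ_ξ_left (hS : S.IsContactMetric) : S.phiEnd.D x (S.ξ x) v = 0 := by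
  rw [D_φ_ξ_left_aux _ hS, shape_φ _ hS]; simp

/-- `h = φ(∇ξ + φ)`. -/
lemma h_eq (hS : S.IsContactMetric) {X : Π x : M, TangentSpace I x} (hX : IsSmoothField X) :
    S.h X = fun x => S.φ x (S.shape x (X x)) := by
  funext x
  have h1 := EndField.nabla_app (ψ := S.phiEnd) S.smooth_ξ hX x
  -- With ∇_ξφ = 0, only ∇ξ contributes to L_ξφ.
  rw [D_φ_ξ_left _ hS, zero_add] at h1
  change nabla S.ξ (S.phi X) x = S.φ x _ at h1
  simp only [h, mlieBracket_eq S.smooth_ξ (phi_smooth (S := S) hX),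
    mlieBracket_eq S.smooth_ξ hX, Pi.smul_apply, Pi.sub_apply, h1, nabla_ξ, phi, map_sub,
    shape_φ _ hS]
  module

/-- The derivative of Aφ + φA = 0. -/
lemma D_shape_φ (hS : S.IsContactMetric) :
    (shapeEnd hS).D x u (S.φ x v) + S.shape x (S.phiEnd.D x u v)
      + S.phiEnd.D x u (S.shape x v) + S.φ x ((shapeEnd hS).D x u v) = 0 := by
  obtain ⟨X, hX, rfl⟩ := exists_smoothField (I := I) u
  obtain ⟨Y, hY, rfl⟩ := exists_smoothField (I := I) v
  have hφ : IsSmoothField (S.phiEnd.app Y) := S.phiEnd.app_smooth hY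
  have hs : IsSmoothField ((shapeEnd hS).app Y) := (shapeEnd hS).app_smooth hY
  have e : (shapeEnd hS).app (S.phiEnd.app Y) + S.phiEnd.app ((shapeEnd hS).app Y) = 0 := by
    funext y
    simp [EndField.app, phiEnd, shapeEnd, shape_φ _ hS]
  have h1 := congrFun (nabla_add (X := X) ((shapeEnd hS).app_smooth hφ)
    (S.phiEnd.app_smooth hs)) x
  rw [e, nabla_zero, Pi.add_apply, EndField.nabla_app hX hφ, EndField.nabla_app hX hs,
    EndField.nabla_app hX hY, EndField.nabla_app hX hY] at h1
  have h2 := shape_φ (nabla X Y x) hS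
  simp only [phiEnd_toFun, shapeEnd_toFun, map_add, EndField.app, Pi.zero_apply] at h1 h2 ⊢
  linear_combination (norm := module) (-1 : ℝ) • h1 + (-1 : ℝ) • h2

end derivatives

end AlmostContactMetric

/-! ### Pointwise linear algebra of the first covariant derivatives -/

section firstOrder

variable {V : Type*} [NormedAddCommGroup V] [InnerProductSpace ℝ V]

/-- The algebraic identities satisfied at a point by an almost contact structure `(φ, ξ)`, a
symmetric operator `S` anticommuting with `φ` such that `S² = 1 - κ` on the contact distribution,
the covariant derivatives `P` of `φ` and `Q` of `S`, and the differential `α` of `κ`. -/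
structure FirstOrder (φ S : V →ₗ[ℝ] V) (ξ : V) (P Q : V →ₗ[ℝ] V →ₗ[ℝ] V) (α : V →ₗ[ℝ] ℝ)
    (κ : ℝ) : Prop where
  φ_φ : ∀ u, φ (φ u) = -u + (inner ℝ ξ u : ℝ) • ξ
  inner_φ : ∀ u v, (inner ℝ (φ u) v : ℝ) = -inner ℝ u (φ v)
  ξ_φ : ∀ u, (inner ℝ ξ (φ u) : ℝ) = 0
  ξ_S : ∀ u, (inner ℝ ξ (S u) : ℝ) = 0
  S_φ : ∀ u, S (φ u) = -φ (S u)
  S_S : ∀ u, (inner ℝ ξ u : ℝ) = 0 → S (S u) = (1 - κ) • u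
  P_skew : ∀ u v w, (inner ℝ (P u v) w : ℝ) = -inner ℝ v (P u w)
  P_cyclic : ∀ u v w, (inner ℝ (P u v) w : ℝ) + inner ℝ (P v w) u + inner ℝ (P w u) v = 0
  P_φ : ∀ u v w, (inner ℝ ξ v : ℝ) = 0 → (inner ℝ ξ w : ℝ) = 0 →
    (inner ℝ (P u (φ v)) w : ℝ) = inner ℝ (P u v) (φ w)
  Q_symm : ∀ u v w, (inner ℝ (Q u v) w : ℝ) = inner ℝ v (Q u w)
  Q_S : ∀ u v w, (inner ℝ ξ v : ℝ) = 0 → (inner ℝ ξ w : ℝ) = 0 →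
    (inner ℝ (Q u (S v)) w : ℝ) + inner ℝ (S (Q u v)) w = -α u * inner ℝ v w
  S_symm : ∀ u v, (inner ℝ (S u) v : ℝ) = inner ℝ u (S v)
  Q_φ : ∀ u v, Q u (φ v) + S (P u v) + P u (S v) + φ (Q u v) = 0
  codazzi : ∀ u v w, (inner ℝ ξ u : ℝ) = 0 → (inner ℝ ξ v : ℝ) = 0 → (inner ℝ ξ w : ℝ) = 0 →
    (inner ℝ (Q u v - Q v u - P u v + P v u) w : ℝ) = 0

namespace FirstOrder

variable {φ S : V →ₗ[ℝ] V} {ξ : V} {P Q : V →ₗ[ℝ] V →ₗ[ℝ] V} {α : V →ₗ[ℝ] ℝ} {κ l : ℝ}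

/-- The part of the `l`-eigenspace of `S` orthogonal to `ξ`. -/
def Eig (S : V →ₗ[ℝ] V) (ξ : V) (l : ℝ) (u : V) : Prop := (inner ℝ ξ u : ℝ) = 0 ∧ S u = l • u

lemma Eig.φ_mem (h : FirstOrder φ S ξ P Q α κ) {u : V} (hu : Eig S ξ l u) :
    Eig S ξ (-l) (φ u) :=
  ⟨h.ξ_φ u, by rw [h.S_φ, hu.2, map_smul, neg_smul]⟩

lemma Eig.φ_φ (h : FirstOrder φ S ξ P Q α κ) {u : V} (hu : Eig S ξ l u) : φ (φ u) = -u := by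
  rw [h.φ_φ, hu.1, zero_smul, add_zero]

/-- Codazzi gives P(u,v) - P(v,u), and the cyclic identity turns this difference into a single value
of P. Hence Q determines the horizontal part of P. -/
lemma codazzi' (h : FirstOrder φ S ξ P Q α κ) {u v w : V} (hu : (inner ℝ ξ u : ℝ) = 0)
    (hv : (inner ℝ ξ v : ℝ) = 0) (hw : (inner ℝ ξ w : ℝ) = 0) :
    (inner ℝ (P w v) u : ℝ) = inner ℝ (Q u v) w - inner ℝ (Q v u) w := by
  have h1 := h.codazzi u v w hu hv hw
  have h2 := h.P_cyclic u v w
  have h3 := h.P_skew v w u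
  have h4 := h.P_skew w u v
  simp only [inner_add_left, inner_sub_left] at h1
  have h5 := real_inner_comm w (P v u)
  have h6 := real_inner_comm u (P w v)
  linarith

/-- On one eigenspace both terms of `Q_S` contribute the same factor l. -/
lemma Q_eig (h : FirstOrder φ S ξ P Q α κ) (hl : l ≠ 0) (y : V) {z x : V} (hz : Eig S ξ l z)
    (hx : Eig S ξ l x) : (inner ℝ (Q y z) x : ℝ) = -α y / (2 * l) * inner ℝ z x := by
  have h1 := h.Q_S y z x hz.1 hx.1
  rw [h.S_symm, hx.2, hz.2, map_smul, inner_smul_left, inner_smul_right] at h1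
  field_simp
  simp at h1
  linarith

lemma inner_φ_φ (h : FirstOrder φ S ξ P Q α κ) {u : V} (v : V) (hu : Eig S ξ l u) :
    (inner ℝ (φ u) (φ v) : ℝ) = inner ℝ u v := by
  have := h.inner_φ (φ u) v
  rw [hu.φ_φ h, inner_neg_left] at this
  linarith

lemma P_eig (h : FirstOrder φ S ξ P Q α κ) (hl : l ≠ 0) {x y z : V} (hx : Eig S ξ l x)
    (hy : Eig S ξ l y) (hz : Eig S ξ l z) :
    (inner ℝ (P x z) y : ℝ)
      = -α y / (2 * l) * inner ℝ z x - -α z / (2 * l) * inner ℝ y x := by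
  rw [h.codazzi' hy.1 hz.1 hx.1, h.Q_eig hl y hz hx, h.Q_eig hl z hy hx]

/-- This is `P_eig` on the (-l)-eigenspace at φx, φy, φz, with φ moved across P by `P_φ`. -/
lemma P_eig_φ (h : FirstOrder φ S ξ P Q α κ) (hl : l ≠ 0) {x y z : V} (hx : Eig S ξ l x)
    (hy : Eig S ξ l y) (hz : Eig S ξ l z) :
    (inner ℝ (P (φ x) z) y : ℝ)
      = -α (φ y) / (2 * l) * inner ℝ z x - -α (φ z) / (2 * l) * inner ℝ y x := by
  have h1 := h.P_eig (neg_ne_zero.2 hl) (hx.φ_mem h) (hy.φ_mem h) (hz.φ_mem h)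
  rw [h.P_φ _ _ _ hz.1 (h.ξ_φ y), hy.φ_φ h, h.inner_φ_φ _ hz, h.inner_φ_φ _ hy,
    inner_neg_right] at h1
  have e : 2 * -l = -(2 * l) := by ring
  simp only [e, div_neg] at h1
  linarith

/-- The form T(a,b,c) = ⟨P a (φc), b⟩ is skew in b, c (`B`), and its antisymmetrization in a, b is
known (`A`). As in the uniqueness of the Levi-Civita connection, these two facts determine T. -/
lemma P_eig_mixed (h : FirstOrder φ S ξ P Q α κ) (hl : l ≠ 0) {x y z : V} (hx : Eig S ξ l x)
    (hy : Eig S ξ l y) (hz : Eig S ξ l z) :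
    (inner ℝ (P x (φ z)) y : ℝ)
      = -α (φ y) / (2 * l) * inner ℝ z x - -α (φ z) / (2 * l) * inner ℝ y x := by
  have A {a b c : V} (ha : Eig S ξ l a) (hb : Eig S ξ l b) (hc : Eig S ξ l c) :
      (inner ℝ (P a (φ c)) b : ℝ) - inner ℝ (P b (φ c)) a
        = -(-α (φ a) / (2 * l) * inner ℝ b c - -α (φ b) / (2 * l) * inner ℝ a c) := by
    have h1 := h.P_cyclic a (φ c) b
    have h2 := h.P_eig_φ hl hc ha hb
    have h3 := h.P_skew b a (φ c)
    have h4 := h.P_skew (φ c) a b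
    have h5 := real_inner_comm a (P b (φ c))
    have h6 := real_inner_comm a (P (φ c) b)
    linarith
  have B {a b c : V} (hb : Eig S ξ l b) (hc : Eig S ξ l c) :
      (inner ℝ (P a (φ c)) b : ℝ) = -inner ℝ (P a (φ b)) c := by
    have h1 := h.P_φ a c b hc.1 hb.1
    have h2 := h.P_skew a c (φ b)
    have h3 := real_inner_comm c (P a (φ b))
    linarith
  have a1 := A hx hy hz
  have a2 := A hy hz hx
  have a3 := A hz hx hy
  have b1 := B (a := x) hy hz
  have b2 := B (a := y) hz hx
  have b3 := B (a := z) hx hy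
  simp only [real_inner_comm x, real_inner_comm y z] at *
  linarith

lemma Q_eig_mixed (h : FirstOrder φ S ξ P Q α κ) (hl : l ≠ 0) {x y z : V} (hx : Eig S ξ l x)
    (hy : Eig S ξ l y) (hz : Eig S ξ l z) :
    (inner ℝ (Q y (φ z)) x : ℝ) = -α (φ y) / (2 * l) * inner ℝ z x := by
  have h1 := h.codazzi' hy.1 (h.ξ_φ z) hx.1
  rw [h.P_eig_mixed hl hx hy hz, h.Q_eig hl _ hy hx] at h1
  linarith

/-- The differential of `κ` satisfies a relation which kills it on eigenspaces of dimension at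
least two. -/
lemma α_relation (h : FirstOrder φ S ξ P Q α κ) (hl : l ≠ 0) {w y z : V} (hw : Eig S ξ l w)
    (hy : Eig S ξ l y) (hz : Eig S ξ l z) : α w * inner ℝ z y = α z * inner ℝ w y := by
  -- All terms of this component of the differentiated relation Aφ = -φA are known multiples of α.
  have h1 := congrArg (fun v => (inner ℝ v w : ℝ)) (h.Q_φ y z)
  simp only [inner_add_left, inner_zero_left, h.S_symm, h.inner_φ, hw.2, hz.2, map_smul,
    inner_smul_left, inner_smul_right] at h1
  have h2 := h.Q_symm y z (φ w)
  rw [real_inner_comm (Q y (φ w))] at h2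
  rw [h2, h.Q_eig_mixed hl hw hy hz, h.Q_eig_mixed hl hz hy hw, h.P_eig hl hy hw hz] at h1
  simp only [real_inner_comm z] at h1 ⊢
  simp at h1
  field_simp at h1
  exact mul_left_cancel₀ hl (by linear_combination (-1 / 2) * h1)

lemma α_eq_zero (h : FirstOrder φ S ξ P Q α κ) (hl : l ≠ 0) {w z : V} (hw : Eig S ξ l w)
    (hz : Eig S ξ l z) (hz0 : z ≠ 0) (hwz : (inner ℝ w z : ℝ) = 0) : α w = 0 := by
  have h1 := h.α_relation hl hw hz hz
  rw [hwz, mul_zero] at h1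
  exact (mul_eq_zero.1 h1).resolve_right (inner_self_ne_zero.2 hz0)

/-- A linear form vanishing on the eigenspaces of `S` vanishes on the contact distribution. -/
lemma eq_zero_of_eig (h : FirstOrder φ S ξ P Q α κ) (hl : l ≠ 0) (hκ : l * l = 1 - κ)
    {A : V →ₗ[ℝ] ℝ} (h1 : ∀ u, Eig S ξ l u → A u = 0) (h2 : ∀ u, Eig S ξ (-l) u → A u = 0)
    {u : V} (hu : (inner ℝ ξ u : ℝ) = 0) : A u = 0 := by
  -- The vectors lu + Su and lu - Su are eigenvectors for l and -l, and they add up to 2lu.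
  have a := h1 (l • u + S u) ⟨by rw [inner_add_right, inner_smul_right, hu, h.ξ_S]; ring, by
    rw [map_add, map_smul, h.S_S u hu, ← hκ]; module⟩
  have b := h2 (l • u - S u) ⟨by rw [inner_sub_right, inner_smul_right, hu, h.ξ_S]; ring, by
    rw [map_sub, map_smul, h.S_S u hu, ← hκ]; module⟩
  rw [map_add, map_smul, smul_eq_mul] at a
  rw [map_sub, map_smul, smul_eq_mul] at b
  have : l * A u = 0 := by linarith
  exact (mul_eq_zero.1 this).resolve_left hl

lemma exists_eq_φ (h : FirstOrder φ S ξ P Q α κ) {u : V} (hu : Eig S ξ (-l) u) :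
    ∃ v, Eig S ξ l v ∧ u = φ v := by
  refine ⟨-φ u, ?_, ?_⟩
  · obtain ⟨h1, h2⟩ := hu.φ_mem h
    rw [neg_neg] at h2
    exact ⟨by rw [inner_neg_right, h1, neg_zero], by rw [map_neg, h2, smul_neg]⟩
  · rw [map_neg, hu.φ_φ h, neg_neg]

/-- By linearity z and y may be taken in eigenspaces; each of the four cases is then a formula in α
at horizontal vectors. -/
lemma P_eq_zero_of_eig (h : FirstOrder φ S ξ P Q α κ) (hl : l ≠ 0) (hκ : l * l = 1 - κ)
    (hα : ∀ u, (inner ℝ ξ u : ℝ) = 0 → α u = 0) {x y z : V} (hx : Eig S ξ l x)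
    (hz : (inner ℝ ξ z : ℝ) = 0) (hy : (inner ℝ ξ y : ℝ) = 0) :
    (inner ℝ (P x z) y : ℝ) = 0 := by
  have key1 {z y : V} (hz : Eig S ξ l z) (hy : Eig S ξ l y) :
      (inner ℝ (P x z) y : ℝ) = 0 := by
    rw [h.P_eig hl hx hy hz, hα y hy.1, hα z hz.1]; simp
  have key2 {z y : V} (hz : Eig S ξ (-l) z) (hy : Eig S ξ l y) :
      (inner ℝ (P x z) y : ℝ) = 0 := by
    obtain ⟨z, hz', rfl⟩ := h.exists_eq_φ hz
    rw [h.P_eig_mixed hl hx hy hz', hα _ (h.ξ_φ _), hα _ (h.ξ_φ _)]; simp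
  have key3 {z y : V} (hz : Eig S ξ (-l) z) (hy : Eig S ξ (-l) y) :
      (inner ℝ (P x z) y : ℝ) = 0 := by
    obtain ⟨x, hx', rfl⟩ := h.exists_eq_φ (l := -l) (by rwa [neg_neg])
    rw [h.P_eig_φ (neg_ne_zero.2 hl) hx' hy hz, hα _ (h.ξ_φ _), hα _ (h.ξ_φ _)]; simp
  have key4 {z y : V} (hz : Eig S ξ l z) (hy : Eig S ξ (-l) y) :
      (inner ℝ (P x z) y : ℝ) = 0 := by
    rw [h.P_skew, real_inner_comm, key2 hy hz, neg_zero]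
  have ext {z : V} (hz : (inner ℝ ξ z : ℝ) = 0)
      (H : ∀ y, Eig S ξ l y ∨ Eig S ξ (-l) y → (inner ℝ (P x z) y : ℝ) = 0) {y : V}
      (hy : (inner ℝ ξ y : ℝ) = 0) : (inner ℝ (P x z) y : ℝ) = 0 :=
    h.eq_zero_of_eig hl hκ (A := (innerₗ V) (P x z)) (fun u hu => H u (.inl hu))
      (fun u hu => H u (.inr hu)) hy
  refine h.eq_zero_of_eig hl hκ (A := (innerₗ V).flip y ∘ₗ P x) (fun u hu => ?_)
    (fun u hu => ?_) hz
  · exact ext hu.1 (fun y hy => hy.elim (key1 hu) (key4 hu)) hy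
  · exact ext hu.1 (fun y hy => hy.elim (key2 hu) (key3 hu)) hy

lemma P_eq_zero (h : FirstOrder φ S ξ P Q α κ) (hl : l ≠ 0) (hκ : l * l = 1 - κ)
    (hα : ∀ u, (inner ℝ ξ u : ℝ) = 0 → α u = 0) {x y z : V} (hx : (inner ℝ ξ x : ℝ) = 0)
    (hz : (inner ℝ ξ z : ℝ) = 0) (hy : (inner ℝ ξ y : ℝ) = 0) :
    (inner ℝ (P x z) y : ℝ) = 0 :=
  h.eq_zero_of_eig hl hκ (A := (innerₗ V).flip y ∘ₗ P.flip z)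
    (fun _ hu => h.P_eq_zero_of_eig hl hκ hα hu hz hy)
    (fun _ hu => h.P_eq_zero_of_eig (neg_ne_zero.2 hl) (by linarith) hα hu hz hy) hx

lemma Q_eq_zero_of_eig (h : FirstOrder φ S ξ P Q α κ) (hl : l ≠ 0) (hκ : l * l = 1 - κ)
    (hα : ∀ u, (inner ℝ ξ u : ℝ) = 0 → α u = 0) {x y z : V} (hx : Eig S ξ l x)
    (hz : (inner ℝ ξ z : ℝ) = 0) (hy : (inner ℝ ξ y : ℝ) = 0) :
    (inner ℝ (Q x z) y : ℝ) = 0 := by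
  have key1 {z y : V} (hz : Eig S ξ l z) (hy : Eig S ξ l y) :
      (inner ℝ (Q x z) y : ℝ) = 0 := by
    rw [h.Q_eig hl x hz hy, hα x hx.1]; simp
  have key2 {z y : V} (hz : Eig S ξ (-l) z) (hy : Eig S ξ l y) :
      (inner ℝ (Q x z) y : ℝ) = 0 := by
    obtain ⟨z, hz', rfl⟩ := h.exists_eq_φ hz
    rw [h.Q_eig_mixed hl hy hx hz', hα _ (h.ξ_φ _)]; simp
  have key3 {z y : V} (hz : Eig S ξ (-l) z) (hy : Eig S ξ (-l) y) :
      (inner ℝ (Q x z) y : ℝ) = 0 := by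
    rw [h.Q_eig (neg_ne_zero.2 hl) x hz hy, hα x hx.1]; simp
  have key4 {z y : V} (hz : Eig S ξ l z) (hy : Eig S ξ (-l) y) :
      (inner ℝ (Q x z) y : ℝ) = 0 := by
    rw [h.Q_symm, real_inner_comm, key2 hy hz]
  have ext {z : V} (hz : (inner ℝ ξ z : ℝ) = 0)
      (H : ∀ y, Eig S ξ l y ∨ Eig S ξ (-l) y → (inner ℝ (Q x z) y : ℝ) = 0) {y : V}
      (hy : (inner ℝ ξ y : ℝ) = 0) : (inner ℝ (Q x z) y : ℝ) = 0 :=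
    h.eq_zero_of_eig hl hκ (A := (innerₗ V) (Q x z)) (fun u hu => H u (.inl hu))
      (fun u hu => H u (.inr hu)) hy
  refine h.eq_zero_of_eig hl hκ (A := (innerₗ V).flip y ∘ₗ Q x) (fun u hu => ?_)
    (fun u hu => ?_) hz
  · exact ext hu.1 (fun y hy => hy.elim (key1 hu) (key4 hu)) hy
  · exact ext hu.1 (fun y hy => hy.elim (key2 hu) (key3 hu)) hy

lemma Q_eq_zero (h : FirstOrder φ S ξ P Q α κ) (hl : l ≠ 0) (hκ : l * l = 1 - κ)
    (hα : ∀ u, (inner ℝ ξ u : ℝ) = 0 → α u = 0) {x y z : V} (hx : (inner ℝ ξ x : ℝ) = 0)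
    (hz : (inner ℝ ξ z : ℝ) = 0) (hy : (inner ℝ ξ y : ℝ) = 0) :
    (inner ℝ (Q x z) y : ℝ) = 0 :=
  h.eq_zero_of_eig hl hκ (A := (innerₗ V).flip y ∘ₗ Q.flip z)
    (fun _ hu => h.Q_eq_zero_of_eig hl hκ hα hu hz hy)
    (fun _ hu => h.Q_eq_zero_of_eig (neg_ne_zero.2 hl) (by linarith) hα hu hz hy) hx

/-- In dimension at least five, the part of an eigenspace orthogonal to `ξ` and to a given
eigenvector is nontrivial. -/
lemma exists_eig (h : FirstOrder φ S ξ P Q α κ) (hκ : l * l = 1 - κ)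
    [FiniteDimensional ℝ V] (hV : 5 ≤ Module.finrank ℝ V) {w : V} (hw : Eig S ξ l w) :
    ∃ z, Eig S ξ l z ∧ z ≠ 0 ∧ (inner ℝ w z : ℝ) = 0 := by
  -- A vector v orthogonal to K gives lv + Sv in the l-eigenspace. If this is zero, v lies in the
  -- (-l)-eigenspace and φv is used instead; orthogonality to φw ensures φv ⟂ w.
  let K : Submodule ℝ V := Submodule.span ℝ (Set.range ![ξ, w, φ w])
  have hK : Module.finrank ℝ K ≤ 3 :=
    (finrank_range_le_card (R := ℝ) ![ξ, w, φ w]).trans (by simp)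
  have hK' : Kᗮ ≠ ⊥ := by
    intro hb
    have := K.finrank_add_finrank_orthogonal
    rw [hb, finrank_bot] at this
    omega
  obtain ⟨v, hv, hv0⟩ := Submodule.exists_mem_ne_zero_of_ne_bot hK'
  rw [Submodule.mem_orthogonal] at hv
  have v1 := hv ξ (Submodule.subset_span ⟨0, rfl⟩)
  have v2 := hv w (Submodule.subset_span ⟨1, rfl⟩)
  have v3 := hv (φ w) (Submodule.subset_span ⟨2, rfl⟩)
  by_cases hz : l • v + S v = 0
  · have hSv : S v = -l • v := by rw [neg_smul]; exact eq_neg_of_add_eq_zero_right hz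
    have hve : Eig S ξ (-l) v := ⟨v1, hSv⟩
    refine ⟨φ v, by simpa using hve.φ_mem h, fun h0 => hv0 ?_, ?_⟩
    · have := hve.φ_φ h
      rw [h0, map_zero] at this
      simpa using this.symm
    · have := h.inner_φ w v
      linarith
  · refine ⟨l • v + S v, ⟨?_, ?_⟩, hz, ?_⟩
    · rw [inner_add_right, inner_smul_right, v1, h.ξ_S]; ring
    · rw [map_add, map_smul, h.S_S v v1, ← hκ]; module
    · rw [inner_add_right, inner_smul_right, v2, ← h.S_symm, hw.2, inner_smul_left, v2]; simp

/-- In dimension at least five, `κ` is stationary along the contact distribution where it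
differs from `1`. -/
lemma α_eq_zero_of_finrank (h : FirstOrder φ S ξ P Q α κ) (hl : l ≠ 0) (hκ : l * l = 1 - κ)
    [FiniteDimensional ℝ V] (hV : 5 ≤ Module.finrank ℝ V) (u : V)
    (hu : (inner ℝ ξ u : ℝ) = 0) : α u = 0 := by
  refine h.eq_zero_of_eig hl hκ (fun w hw => ?_) (fun w hw => ?_) hu
  · obtain ⟨z, hz, hz0, hwz⟩ := h.exists_eig hκ hV hw
    exact h.α_eq_zero hl hw hz hz0 hwz
  · obtain ⟨z, hz, hz0, hwz⟩ := h.exists_eig (l := -l) (by linarith) hV hw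
    exact h.α_eq_zero (neg_ne_zero.2 hl) hw hz hz0 hwz

end FirstOrder

end firstOrder

/-! ### The (κ,μ,ν) equation and the relation A² = 1 - κ -/

namespace AlmostContactMetric

variable {S : AlmostContactMetric I M} [T2Space M] {f₁ f₂ f₃ f₄ f₅ f₆ f₇ f₈ : M → ℝ}

/-- Here κ, μ, ν appear as f₁ - f₃, f₄ - f₆, f₇ - f₈; the last term carries a minus sign because φh
= φ²A = -A. -/
lemma curvature_ξ_eq (hS : S.IsContactMetric)
    (hR : S.IsGeneralizedSpaceForm f₁ f₂ f₃ f₄ f₅ f₆ f₇ f₈)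
    {X Y : Π x : M, TangentSpace I x} (hX : IsSmoothField X) (hY : IsSmoothField Y) (x : M) :
    curvature X Y S.ξ x =
      (f₁ - f₃) x • ((inner ℝ (S.ξ x) (Y x) : ℝ) • X x - (inner ℝ (S.ξ x) (X x) : ℝ) • Y x)
      + (f₄ - f₆) x • ((inner ℝ (S.ξ x) (Y x) : ℝ) • S.φ x (S.shape x (X x))
        - (inner ℝ (S.ξ x) (X x) : ℝ) • S.φ x (S.shape x (Y x)))
      - (f₇ - f₈) x • ((inner ℝ (S.ξ x) (Y x) : ℝ) • S.shape x (X x)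
        - (inner ℝ (S.ξ x) (X x) : ℝ) • S.shape x (Y x)) := by
  have hξ (u : TangentSpace I x) : (inner ℝ (S.φ x u) (S.ξ x) : ℝ) = 0 := by
    rw [real_inner_comm, inner_ξ_φ]
  rw [hR.curvature_eq X Y S.ξ hX hY S.smooth_ξ]
  simp only [R₁, R₂, R₃, R₄, R₅, R₆, R₇, R₈, h_eq hS hX, h_eq hS hY, metric, phi, eta_eq_metric,
    Pi.add_apply, Pi.sub_apply, Pi.smul_apply', Pi.smul_apply, Pi.mul_apply, φ_φ_eq, φ_ξ,
    inner_ξ_shape_sub, inner_ξ_ξ, hξ, inner_add_right, inner_neg_right, inner_smul_right,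
    inner_zero_right, real_inner_comm (S.ξ x)]
  module

section pointwise

variable {x : M}

/-- Two evaluations of R(u,ξ)ξ: by covariant derivatives and by the space form. -/
lemma jacobi_operator_eq (hS : S.IsContactMetric)
    (hR : S.IsGeneralizedSpaceForm f₁ f₂ f₃ f₄ f₅ f₆ f₇ f₈) (u : TangentSpace I x) :
    -S.shape x (S.shape x u) - S.φ x (S.φ x u) - (shapeEnd hS).D x (S.ξ x) u
      = (f₁ - f₃) x • (u - (inner ℝ (S.ξ x) u : ℝ) • S.ξ x)
        + (f₄ - f₆) x • S.φ x (S.shape x u) - (f₇ - f₈) x • S.shape x u := by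
  obtain ⟨X, hX, rfl⟩ := exists_smoothField (I := I) u
  have h1 := curvature_ξ_eq hS hR hX S.smooth_ξ x
  rw [curvature_ξ hS hX S.smooth_ξ, D_shape_ξ_right _ hS, D_φ_ξ_right, D_φ_ξ_left _ hS] at h1
  simp only [map_sub, shape_φ _ hS, shape_ξ hS, inner_ξ_ξ, map_zero, smul_zero] at h1
  linear_combination (norm := module) h1

/-- As ∇_ξφ = 0, the operator ∇_ξA anticommutes with φ, just as A does. -/
lemma D_shape_ξ_left_φ (hS : S.IsContactMetric) (u : TangentSpace I x) :
    S.φ x ((shapeEnd hS).D x (S.ξ x) (S.φ x u)) = (shapeEnd hS).D x (S.ξ x) u := by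
  have h1 := D_shape_φ (S.ξ x) u hS
  rw [D_φ_ξ_left _ hS, D_φ_ξ_left _ hS, map_zero, add_zero, add_zero] at h1
  have h2 := inner_D_shape (S.ξ x) (S.ξ x) u hS
  rw [D_shape_ξ_right, shape_ξ hS, φ_ξ, sub_zero, map_zero, neg_zero, inner_zero_left] at h2
  rw [eq_neg_of_add_eq_zero_left h1, map_neg, φ_φ_eq, ← h2]
  module

/-- Replacing the Jacobi operator J by φJφ preserves the terms anticommuting with φ and changes the
sign of the commuting ones on the contact distribution. The difference isolates A². -/
lemma shape_shape (hS : S.IsContactMetric)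
    (hR : S.IsGeneralizedSpaceForm f₁ f₂ f₃ f₄ f₅ f₆ f₇ f₈) (u : TangentSpace I x) :
    S.shape x (S.shape x u) = (1 - (f₁ - f₃) x) • (u - (inner ℝ (S.ξ x) u : ℝ) • S.ξ x) := by
  have h1 := jacobi_operator_eq hS hR u
  have h2 := congrArg (S.φ x) (jacobi_operator_eq hS hR (S.φ x u))
  simp only [map_sub, map_add, map_neg, map_smul, D_shape_ξ_left_φ, shape_φ _ hS, φ_φ_eq,
    inner_ξ_φ, inner_ξ_shape_sub, φ_ξ, zero_smul, smul_zero, smul_neg, map_zero] at h1 h2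
  linear_combination (norm := module) (-1 / 2 : ℝ) • h1 + (1 / 2 : ℝ) • h2

lemma D_shape_ξ_left (hS : S.IsContactMetric)
    (hR : S.IsGeneralizedSpaceForm f₁ f₂ f₃ f₄ f₅ f₆ f₇ f₈) (u : TangentSpace I x) :
    (shapeEnd hS).D x (S.ξ x) u
      = -((f₄ - f₆) x • S.φ x (S.shape x u)) + (f₇ - f₈) x • S.shape x u := by
  have h1 := jacobi_operator_eq hS hR u
  rw [shape_shape hS hR, φ_φ_eq] at h1
  linear_combination (norm := module) (-1 : ℝ) • h1

lemma kappa_smooth (hR : S.IsGeneralizedSpaceForm f₁ f₂ f₃ f₄ f₅ f₆ f₇ f₈) :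
    ContMDiff I 𝓘(ℝ) ∞ (f₁ - f₃) :=
  hR.smooth.1.sub hR.smooth.2.2.1

/-- The derivative of A² = (1 - κ)(1 - η ⊗ ξ). -/
lemma D_shape_shape (hS : S.IsContactMetric)
    (hR : S.IsGeneralizedSpaceForm f₁ f₂ f₃ f₄ f₅ f₆ f₇ f₈) (u v : TangentSpace I x) :
    (shapeEnd hS).D x u (S.shape x v) + S.shape x ((shapeEnd hS).D x u v)
      = -(mvfderiv I (f₁ - f₃) x u) • (v - (inner ℝ (S.ξ x) v : ℝ) • S.ξ x)
        - (1 - (f₁ - f₃) x) • ((inner ℝ (S.shape x u - S.φ x u) v : ℝ) • S.ξ x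
          + (inner ℝ (S.ξ x) v : ℝ) • (S.shape x u - S.φ x u)) := by
  obtain ⟨X, hX, rfl⟩ := exists_smoothField (I := I) u
  obtain ⟨Y, hY, rfl⟩ := exists_smoothField (I := I) v
  have hs : IsSmoothField ((shapeEnd hS).app Y) := (shapeEnd hS).app_smooth hY
  have hm := metric_smooth S.smooth_ξ hY
  have hκ := kappa_smooth hR
  have hp := hY.sub (S.smooth_ξ.smul hm)
  have e : (shapeEnd hS).app ((shapeEnd hS).app Y)
      = (Y - metric S.ξ Y • S.ξ) - (f₁ - f₃) • (Y - metric S.ξ Y • S.ξ) := by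
    funext y
    simp only [EndField.app, shapeEnd_toFun, shape_shape hS hR, Pi.sub_apply, Pi.smul_apply',
      metric]
    module
  have h1 := EndField.nabla_app (ψ := shapeEnd hS) hX hs x
  have h4 := congrFun (dirDeriv_metric hX S.smooth_ξ hY) x
  rw [EndField.nabla_app hX hY, e, nabla_sub hp (hp.smul hκ), nabla_smul hκ hp,
    nabla_sub hY (S.smooth_ξ.smul hm), nabla_smul hm S.smooth_ξ] at h1
  simp only [Pi.sub_apply, Pi.add_apply, Pi.smul_apply', h4] at h1
  simp only [Pi.sub_apply, EndField.app, shapeEnd_toFun,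
    map_add, shape_shape hS hR, metric, nabla_ξ, dirDeriv] at h1 ⊢
  linear_combination (norm := module) (-1 : ℝ) • h1

lemma firstOrder (hS : S.IsContactMetric)
    (hR : S.IsGeneralizedSpaceForm f₁ f₂ f₃ f₄ f₅ f₆ f₇ f₈) (x : M) :
    FirstOrder (S.φ x : TangentSpace I x →ₗ[ℝ] TangentSpace I x)
      (S.shape x : TangentSpace I x →ₗ[ℝ] TangentSpace I x) (S.ξ x) (S.phiEnd.D x)
      ((shapeEnd hS).D x) (mvfderiv I (f₁ - f₃) x : TangentSpace I x →ₗ[ℝ] ℝ)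
      ((f₁ - f₃) x) where
  φ_φ := φ_φ_eq
  inner_φ := inner_φ_left
  ξ_φ := inner_ξ_φ
  ξ_S := inner_ξ_shape_sub x
  S_φ u := shape_φ u hS
  S_S u hu := by
    change S.shape x (S.shape x u) = _
    rw [shape_shape hS hR, hu]; simp
  P_skew := inner_D_φ
  P_cyclic u v w := D_φ_cyclic u v w hS
  P_φ u v w hv hw := by
    have h1 := congrArg (fun z => (inner ℝ z w : ℝ)) (D_φ_φ (S := S) u v)
    simp only [inner_add_left, inner_smul_left, hw, hv, inner_φ_left (S := S) _ w] at h1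
    simp at h1
    change (inner ℝ (S.phiEnd.D x u (S.φ x v)) w : ℝ) = inner ℝ (S.phiEnd.D x u v) (S.φ x w)
    linarith
  Q_symm u v w := inner_D_shape u v w hS
  Q_S u v w hv hw := by
    have h1 := congrArg (fun z => (inner ℝ z w : ℝ)) (D_shape_shape hS hR u v)
    simp only [inner_add_left, inner_sub_left, inner_smul_left, hw, hv] at h1
    simp at h1
    simpa using h1
  S_symm := inner_shape_left hS x
  Q_φ u v := D_shape_φ u v hS
  codazzi u v w hu hv hw := by
    obtain ⟨X, hX, rfl⟩ := exists_smoothField (I := I) u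
    obtain ⟨Y, hY, rfl⟩ := exists_smoothField (I := I) v
    rw [← curvature_ξ hS hX hY, curvature_ξ_eq hS hR hX hY, hu, hv]
    simp

end pointwise

end AlmostContactMetric

/-- A smooth function with vanishing differential on a connected manifold without boundary is
constant. -/
lemma eq_of_mvfderiv_eq_zero [I.Boundaryless] [ConnectedSpace M] {f : M → ℝ}
    (hf : ContMDiff I 𝓘(ℝ) ∞ f) (h : ∀ x (u : TangentSpace I x), mvfderiv I f x u = 0)
    (x y : M) : f x = f y := by
  have h0 (x : M) : mfderiv I 𝓘(ℝ) f x = 0 := by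
    ext u; exact h x u
  suffices H : IsLocallyConstant f from H.apply_eq_of_preconnectedSpace x y
  rw [IsLocallyConstant.iff_eventually_eq]
  intro p
  obtain ⟨r, hr, hb⟩ := Metric.mem_nhds_iff.1 (extChartAt_target_mem_nhds (I := I) p)
  have hd : ∀ z ∈ Metric.ball (extChartAt I p p) r,
      HasFDerivAt (f ∘ (extChartAt I p).symm) (0 : E →L[ℝ] ℝ) z := by
    intro z hz
    have h1 : MDifferentiableAt 𝓘(ℝ, E) I (extChartAt I p).symm z :=
      ((contMDiffOn_extChartAt_symm (n := ∞) p).contMDiffAt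
        ((isOpen_extChartAt_target p).mem_nhds (hb hz))).mdifferentiableAt (by simp)
    have h2 := (mdiffAt_of_smooth hf ((extChartAt I p).symm z)).hasMFDerivAt.comp z
      h1.hasMFDerivAt
    rw [h0, ContinuousLinearMap.zero_comp] at h2
    exact h2.hasFDerivAt
  have hn : ∀ᶠ q in 𝓝 p, extChartAt I p q ∈ Metric.ball (extChartAt I p p) r :=
    (continuousAt_extChartAt p).eventually (Metric.ball_mem_nhds _ hr)
  filter_upwards [hn, extChartAt_source_mem_nhds (I := I) p] with q hq hq'
  have := Metric.isOpen_ball.is_const_of_fderiv_eq_zero (𝕜 := ℝ)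
    (convex_ball (extChartAt I p p) r).isPreconnected
    (fun z hz => (hd z hz).differentiableAt.differentiableWithinAt)
    (fun z hz => (hd z hz).fderiv) hq (Metric.mem_ball_self hr)
  rwa [Function.comp_apply, Function.comp_apply, (extChartAt I p).left_inv hq',
    extChartAt_to_inv] at this

lemma exists_orthogonal {V : Type*} [NormedAddCommGroup V] [InnerProductSpace ℝ V]
    [FiniteDimensional ℝ V] (hV : 2 ≤ Module.finrank ℝ V) (ξ : V) :
    ∃ v : V, v ≠ 0 ∧ (inner ℝ ξ v : ℝ) = 0 := by
  have h : (Submodule.span ℝ {ξ})ᗮ ≠ ⊥ := by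
    intro hb
    have h1 := (Submodule.span ℝ {ξ}).finrank_add_finrank_orthogonal
    have h2 : Module.finrank ℝ (Submodule.span ℝ {ξ}) ≤ 1 :=
      (finrank_span_le_card ({ξ} : Set V)).trans (by simp)
    rw [hb, finrank_bot] at h1
    omega
  obtain ⟨v, hv, hv0⟩ := Submodule.exists_mem_ne_zero_of_ne_bot h
  exact ⟨v, hv0, (Submodule.mem_orthogonal_singleton_iff_inner_right).1 hv⟩

/-! ### Constancy of κ -/

namespace AlmostContactMetric

variable {S : AlmostContactMetric I M} [T2Space M] {f₁ f₂ f₃ f₄ f₅ f₆ f₇ f₈ : M → ℝ}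

lemma inner_shape_shape (hS : S.IsContactMetric)
    (hR : S.IsGeneralizedSpaceForm f₁ f₂ f₃ f₄ f₅ f₆ f₇ f₈) {x : M} {u : TangentSpace I x}
    (hu : (inner ℝ (S.ξ x) u : ℝ) = 0) :
    (inner ℝ (S.shape x u) (S.shape x u) : ℝ) = (1 - (f₁ - f₃) x) * inner ℝ u u := by
  rw [inner_shape_left hS, shape_shape hS hR, hu, zero_smul, sub_zero, inner_smul_right]

lemma kappa_le_one (hS : S.IsContactMetric)
    (hR : S.IsGeneralizedSpaceForm f₁ f₂ f₃ f₄ f₅ f₆ f₇ f₈) (hE : 2 ≤ Module.finrank ℝ E)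
    (x : M) : (f₁ - f₃) x ≤ 1 := by
  obtain ⟨v, hv0, hv⟩ := exists_orthogonal (V := TangentSpace I x) hE (S.ξ x)
  have h1 := inner_shape_shape hS hR hv
  have h2 : (0 : ℝ) ≤ inner ℝ (S.shape x v) (S.shape x v) := real_inner_self_nonneg
  have h3 : (0 : ℝ) < inner ℝ v v := real_inner_self_pos.2 hv0
  rw [h1] at h2
  linarith [nonneg_of_mul_nonneg_left h2 h3]

/-- Differentiate |AW|² + κ|W|² = |W|² for a horizontal field W. Since AW = 0 at x, the first term
has zero derivative there. -/
lemma mvfderiv_kappa_of_eq_one (hS : S.IsContactMetric)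
    (hR : S.IsGeneralizedSpaceForm f₁ f₂ f₃ f₄ f₅ f₆ f₇ f₈) (hE : 2 ≤ Module.finrank ℝ E)
    {x : M} (hx : (f₁ - f₃) x = 1) (u : TangentSpace I x) :
    mvfderiv I (f₁ - f₃) x u = 0 := by
  obtain ⟨v, hv0, hv⟩ := exists_orthogonal (V := TangentSpace I x) hE (S.ξ x)
  obtain ⟨X, hX, rfl⟩ := exists_smoothField (I := I) u
  obtain ⟨V, hV, rfl⟩ := exists_smoothField (I := I) v
  have hm := metric_smooth S.smooth_ξ hV
  have hW := hV.sub (S.smooth_ξ.smul hm)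
  set W := V - metric S.ξ V • S.ξ with hWdef
  have hWx : W x = V x := by simp [W, metric, hv]
  have hWξ (y : M) : (inner ℝ (S.ξ y) (W y) : ℝ) = 0 := by
    simp only [W, metric, Pi.sub_apply, Pi.smul_apply', inner_sub_right, inner_smul_right,
      inner_ξ_ξ]
    ring
  have hs : IsSmoothField ((shapeEnd hS).app W) := (shapeEnd hS).app_smooth hW
  have hκ := kappa_smooth hR
  have e : metric ((shapeEnd hS).app W) ((shapeEnd hS).app W) + (f₁ - f₃) * metric W W
      = metric W W := by
    funext y
    have := inner_shape_shape hS hR (hWξ y)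
    simp only [metric, EndField.app, shapeEnd_toFun, this, Pi.add_apply, Pi.mul_apply]
    ring
  have h0 : (shapeEnd hS).app W x = 0 := by
    have := inner_shape_shape hS hR (hWξ x)
    rw [hx, sub_self, zero_mul] at this
    exact inner_self_eq_zero.1 this
  have h1 := congrFun (congrArg (dirDeriv X) e) x
  rw [dirDeriv_add (metric_smooth hs hs) (hκ.mul (metric_smooth hW hW)),
    dirDeriv_mul hκ (metric_smooth hW hW), dirDeriv_metric hX hs hs] at h1
  simp only [Pi.add_apply, Pi.mul_apply, metric, h0, hx, inner_zero_left, inner_zero_right,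
    hWx] at h1
  have h2 : (inner ℝ (V x) (V x) : ℝ) * mvfderiv I (f₁ - f₃) x (X x) = 0 := by
    have : dirDeriv X (f₁ - f₃) x = mvfderiv I (f₁ - f₃) x (X x) := rfl
    rw [← this]
    linear_combination h1
  exact (mul_eq_zero.1 h2).resolve_left (inner_self_ne_zero.2 hv0)

lemma mvfderiv_kappa_horizontal (hS : S.IsContactMetric)
    (hR : S.IsGeneralizedSpaceForm f₁ f₂ f₃ f₄ f₅ f₆ f₇ f₈) (hE : 5 ≤ Module.finrank ℝ E)
    {x : M} (u : TangentSpace I x) (hu : (inner ℝ (S.ξ x) u : ℝ) = 0) :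
    mvfderiv I (f₁ - f₃) x u = 0 := by
  rcases (kappa_le_one hS hR (by omega) x).lt_or_eq with h | h
  · have hs : Real.sqrt (1 - (f₁ - f₃) x) ≠ 0 := (Real.sqrt_pos.2 (by linarith)).ne'
    exact (firstOrder hS hR x).α_eq_zero_of_finrank hs
      (Real.mul_self_sqrt (by linarith)) hE u hu
  · exact mvfderiv_kappa_of_eq_one hS hR (by omega) h u

/-- Horizontally dκ = 0, so dκ = aη with a = ξ(κ). The commutator of φY and Y applied to κ, for Y
horizontal at x, gives 2a dη(φY, Y) = 0, while dη(φY, Y) = |Y|² there. -/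
lemma mvfderiv_kappa (hS : S.IsContactMetric)
    (hR : S.IsGeneralizedSpaceForm f₁ f₂ f₃ f₄ f₅ f₆ f₇ f₈) (hE : 5 ≤ Module.finrank ℝ E)
    {x : M} (u : TangentSpace I x) : mvfderiv I (f₁ - f₃) x u = 0 := by
  have hκ := kappa_smooth hR
  have hd := dirDeriv_smooth S.smooth_ξ hκ
  have split {y : M} (w : TangentSpace I y) : mvfderiv I (f₁ - f₃) y w
      = dirDeriv S.ξ (f₁ - f₃) y * inner ℝ (S.ξ y) w := by
    have h1 := mvfderiv_kappa_horizontal hS hR hE (w - (inner ℝ (S.ξ y) w : ℝ) • S.ξ y) (by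
      rw [inner_sub_right, inner_smul_right, inner_ξ_ξ]; ring)
    rw [map_sub, map_smul, smul_eq_mul] at h1
    rw [dirDeriv]
    linarith
  have split' (Y : Π x : M, TangentSpace I x) : dirDeriv Y (f₁ - f₃)
      = dirDeriv S.ξ (f₁ - f₃) * S.eta Y := by
    funext y
    rw [eta_eq_metric]
    exact split (Y y)
  obtain ⟨v, hv0, hv⟩ := exists_orthogonal (V := TangentSpace I x)
    (by change 2 ≤ Module.finrank ℝ E; omega) (S.ξ x)
  obtain ⟨Y, hY, rfl⟩ := exists_smoothField (I := I) v
  have hX := phi_smooth (S := S) hY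
  have h1 := congrFun (dirDeriv_comm S hX hY hκ) x
  have h2 := congrFun (hS (S.phi Y) Y hX hY) x
  have hη {Z : Π x : M, TangentSpace I x} (hZ : IsSmoothField Z) :
      ContMDiff I 𝓘(ℝ) ∞ (S.eta Z) := by
    rw [eta_eq_metric]; exact metric_smooth S.smooth_ξ hZ
  rw [split' (mlieBracket I (S.phi Y) Y), Pi.sub_apply, split' Y, split' (S.phi Y),
    dirDeriv_mul hd (hη hY), dirDeriv_mul hd (hη hX)] at h1
  have e1 : S.eta Y x = 0 := by rw [eta_eq_metric]; exact hv
  have e2 : S.eta (S.phi Y) x = 0 := by rw [eta_eq_metric]; exact inner_ξ_φ _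
  have e3 : metric (S.phi Y) (S.phi Y) x = inner ℝ (Y x) (Y x) := by
    have := S.inner_φ_φ x (Y x) (Y x)
    rw [η_eq, hv, mul_zero, sub_zero] at this
    exact this
  simp only [dEta, Pi.add_apply, Pi.mul_apply, e1, e2, e3] at h1 h2
  have h3 : dirDeriv S.ξ (f₁ - f₃) x * inner ℝ (Y x) (Y x) = 0 := by
    rw [← h2]; linear_combination (-1 / 2 : ℝ) * h1
  rw [split u, (mul_eq_zero.1 h3).resolve_right (inner_self_ne_zero.2 hv0), zero_mul]

/-- The function `κ` is constant. -/
lemma kappa_const [I.Boundaryless] [ConnectedSpace M] (hS : S.IsContactMetric)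
    (hR : S.IsGeneralizedSpaceForm f₁ f₂ f₃ f₄ f₅ f₆ f₇ f₈) (hE : 5 ≤ Module.finrank ℝ E)
    (x y : M) : (f₁ - f₃) x = (f₁ - f₃) y :=
  eq_of_mvfderiv_eq_zero (kappa_smooth hR) (fun _ u => mvfderiv_kappa hS hR hE u) x y

/-- If κ = 1 somewhere, then everywhere; the symmetric A has A² = 0, so A = 0 and h = φA = 0. -/
lemma kappa_lt_one [I.Boundaryless] [ConnectedSpace M] (hS : S.IsContactMetric)
    (hR : S.IsGeneralizedSpaceForm f₁ f₂ f₃ f₄ f₅ f₆ f₇ f₈) (hE : 5 ≤ Module.finrank ℝ E)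
    (hh : S.HNeZero) (x : M) : (f₁ - f₃) x < 1 := by
  refine lt_of_le_of_ne (kappa_le_one hS hR (by omega) x) fun h1 => ?_
  obtain ⟨X, hX, hne⟩ := hh
  refine hne (funext fun y => ?_)
  rw [kappa_const hS hR hE x y] at h1
  have h2 := shape_shape hS hR (X y)
  rw [h1, sub_self, zero_smul] at h2
  have h3 := inner_shape_left hS y (X y) (S.shape y (X y))
  rw [h2, inner_zero_right] at h3
  rw [h_eq hS hX]
  change S.φ y (S.shape y (X y)) = 0
  rw [inner_self_eq_zero.1 h3, map_zero]

/-! ### Explicit derivatives of φ and A where κ < 1 -/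

section constant

variable {x : M}

/-- Along ξ, A² has zero derivative because κ is constant. In ∇_ξA = -μφA + νA the φA term
anticommutes with A, so 2νA² = 0 remains. -/
lemma nu_eq_zero (hS : S.IsContactMetric)
    (hR : S.IsGeneralizedSpaceForm f₁ f₂ f₃ f₄ f₅ f₆ f₇ f₈) (hE : 5 ≤ Module.finrank ℝ E)
    (hκ : (f₁ - f₃) x < 1) : (f₇ - f₈) x = 0 := by
  obtain ⟨v, hv0, hv⟩ := exists_orthogonal (V := TangentSpace I x)
    (by change 2 ≤ Module.finrank ℝ E; omega) (S.ξ x)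
  have h1 := D_shape_shape hS hR (S.ξ x) v
  rw [mvfderiv_kappa hS hR hE, D_shape_ξ_left hS hR, D_shape_ξ_left hS hR, shape_ξ hS, φ_ξ] at h1
  simp only [map_add, map_neg, map_smul, shape_φ _ hS, shape_shape hS hR, hv, inner_zero_left,
    sub_zero, zero_smul] at h1
  have h2 : (2 * (f₇ - f₈) x * (1 - (f₁ - f₃) x)) • v = 0 := by
    linear_combination (norm := module) h1
  have h3 := (smul_eq_zero.1 h2).resolve_right hv0
  rcases mul_eq_zero.1 h3 with h4 | h4
  · linarith
  · linarith

/-- A symmetric or skew operator without horizontal block is determined by its value on ξ. -/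
lemma eq_of_vanishing {V : Type*} [NormedAddCommGroup V] [InnerProductSpace ℝ V] {ξ : V}
    (hξ : (inner ℝ ξ ξ : ℝ) = 1) {R : V →ₗ[ℝ] V} {ε : ℝ}
    (hR : ∀ v w, (inner ℝ (R v) w : ℝ) = ε * inner ℝ v (R w)) (hRξ : (inner ℝ ξ (R ξ) : ℝ) = 0)
    (h0 : ∀ v w, (inner ℝ ξ v : ℝ) = 0 → (inner ℝ ξ w : ℝ) = 0 → (inner ℝ (R v) w : ℝ) = 0)
    (v : V) : R v = (ε * inner ℝ v (R ξ)) • ξ + (inner ℝ ξ v : ℝ) • R ξ := by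
  have ho (w : V) : (inner ℝ ξ (w - (inner ℝ ξ w : ℝ) • ξ) : ℝ) = 0 := by
    rw [inner_sub_right, inner_smul_right, hξ]; ring
  refine ext_inner_right ℝ fun w => ?_
  have h1 := h0 _ _ (ho v) (ho w)
  simp only [map_sub, map_smul, inner_sub_left, inner_sub_right, inner_smul_left,
    inner_smul_right, real_inner_comm ξ (R ξ), hRξ, hR v ξ] at h1
  simp only [inner_add_left, inner_smul_left]
  simp at h1 ⊢
  linarith

lemma D_φ_eq (hS : S.IsContactMetric)
    (hR : S.IsGeneralizedSpaceForm f₁ f₂ f₃ f₄ f₅ f₆ f₇ f₈) (hE : 5 ≤ Module.finrank ℝ E)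
    (hκ : (f₁ - f₃) x < 1) (u v : TangentSpace I x) :
    S.phiEnd.D x u v = (inner ℝ (S.φ x u - S.shape x u) (S.φ x v) : ℝ) • S.ξ x
      + (inner ℝ (S.ξ x) v : ℝ) • S.φ x (S.φ x u - S.shape x u) := by
  have hs : Real.sqrt (1 - (f₁ - f₃) x) ≠ 0 := (Real.sqrt_pos.2 (by linarith)).ne'
  have hs' := Real.mul_self_sqrt (show 0 ≤ 1 - (f₁ - f₃) x by linarith)
  have h0 {a b c : TangentSpace I x} (ha : (inner ℝ (S.ξ x) a : ℝ) = 0)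
      (hb : (inner ℝ (S.ξ x) b : ℝ) = 0) (hc : (inner ℝ (S.ξ x) c : ℝ) = 0) :
      (inner ℝ (S.phiEnd.D x a b) c : ℝ) = 0 :=
    (firstOrder hS hR x).P_eq_zero hs hs' (fun u _ => mvfderiv_kappa hS hR hE u) ha hb hc
  have e : S.phiEnd.D x u = S.phiEnd.D x (u - (inner ℝ (S.ξ x) u : ℝ) • S.ξ x) := by
    ext w; rw [map_sub, map_smul, LinearMap.sub_apply, LinearMap.smul_apply, D_φ_ξ_left _ hS]; simp
  have hξ : S.phiEnd.D x u (S.ξ x) = S.φ x (S.φ x u - S.shape x u) := by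
    rw [D_φ_ξ_right, ← map_neg, neg_sub]
  have h1 := eq_of_vanishing (R := S.phiEnd.D x u) (ε := -1) inner_ξ_ξ
    (fun v w => by rw [inner_D_φ]; ring) (by rw [hξ, inner_ξ_φ]) (fun v w hv hw => by
      rw [e]
      exact h0 (by rw [inner_sub_right, inner_smul_right, inner_ξ_ξ]; ring) hv hw) v
  rw [h1, hξ]
  have h2 := inner_φ_left (S := S) v (S.φ x u - S.shape x u)
  rw [real_inner_comm] at h2
  rw [h2, neg_one_mul]

lemma D_shape_eq (hS : S.IsContactMetric)
    (hR : S.IsGeneralizedSpaceForm f₁ f₂ f₃ f₄ f₅ f₆ f₇ f₈) (hE : 5 ≤ Module.finrank ℝ E)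
    (hκ : (f₁ - f₃) x < 1) (u v : TangentSpace I x) :
    (shapeEnd hS).D x u v = (inner ℝ (S.φ x u - S.shape x u) (S.shape x v) : ℝ) • S.ξ x
      + (inner ℝ (S.ξ x) v : ℝ) • S.shape x (S.φ x u - S.shape x u)
      - ((f₄ - f₆) x * inner ℝ (S.ξ x) u) • S.φ x (S.shape x v) := by
  have hs : Real.sqrt (1 - (f₁ - f₃) x) ≠ 0 := (Real.sqrt_pos.2 (by linarith)).ne'
  have hs' := Real.mul_self_sqrt (show 0 ≤ 1 - (f₁ - f₃) x by linarith)
  have h0 {a b c : TangentSpace I x} (ha : (inner ℝ (S.ξ x) a : ℝ) = 0)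
      (hb : (inner ℝ (S.ξ x) b : ℝ) = 0) (hc : (inner ℝ (S.ξ x) c : ℝ) = 0) :
      (inner ℝ ((shapeEnd hS).D x a b) c : ℝ) = 0 :=
    (firstOrder hS hR x).Q_eq_zero hs hs' (fun u _ => mvfderiv_kappa hS hR hE u) ha hb hc
  -- Only the horizontal part of u is covered by `Q_eq_zero`; the ξ-part contributes ∇_ξA = -μφA.
  set u' := u - (inner ℝ (S.ξ x) u : ℝ) • S.ξ x with hu'
  have e : (shapeEnd hS).D x u v = (shapeEnd hS).D x u' v
      - ((f₄ - f₆) x * inner ℝ (S.ξ x) u) • S.φ x (S.shape x v) := by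
    rw [hu', map_sub, map_smul, LinearMap.sub_apply, LinearMap.smul_apply,
      D_shape_ξ_left hS hR, nu_eq_zero hS hR hE hκ]
    module
  have hb : S.φ x u' - S.shape x u' = S.φ x u - S.shape x u := by
    simp only [hu', map_sub, map_smul, φ_ξ, shape_ξ hS, smul_zero, sub_zero]
  have hξ : (shapeEnd hS).D x u' (S.ξ x) = S.shape x (S.φ x u - S.shape x u) := by
    rw [D_shape_ξ_right, ← map_neg, neg_sub, hb]
  have h1 := eq_of_vanishing (R := (shapeEnd hS).D x u') (ε := 1) inner_ξ_ξ
    (fun v w => by rw [inner_D_shape]; ring) (by rw [hξ, inner_ξ_shape_sub])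
    (fun v w hv hw =>
      h0 (by rw [hu', inner_sub_right, inner_smul_right, inner_ξ_ξ]; ring) hv hw) v
  rw [e, h1, hξ, one_mul, ← inner_shape_left hS, real_inner_comm]

end constant

end AlmostContactMetric

/-! ### Ricci identities for φ and A -/

namespace AlmostContactMetric

variable {S : AlmostContactMetric I M} [T2Space M] {x : M}

/-- The form of the covariant derivative of `φ` and of `∇ξ + φ` on a generalized space form: with
`B = -∇ξ`, `(∇_u ψ)v = g(Bu, ψv)ξ + η(v)ψBu - m η(u)χv`. -/
def HasSpecialDerivative (S : AlmostContactMetric I M) (ψ : EndField I M)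
    (m : M → ℝ) (χ : Π x : M, TangentSpace I x →L[ℝ] TangentSpace I x) : Prop :=
  ∀ (x : M) (u v : TangentSpace I x), ψ.D x u v =
    (inner ℝ (S.φ x u - S.shape x u) (ψ.toFun x v) : ℝ) • S.ξ x
      + (inner ℝ (S.ξ x) v : ℝ) • ψ.toFun x (S.φ x u - S.shape x u)
      - (m x * inner ℝ (S.ξ x) u) • χ x v

variable {ψ : EndField I M} {m : M → ℝ}
  {χ : Π x : M, TangentSpace I x →L[ℝ] TangentSpace I x}

lemma inner_ξ_nabla {X Y : Π x : M, TangentSpace I x} (hX : IsSmoothField X)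
    (hY : IsSmoothField Y) (x : M) :
    dirDeriv X (metric S.ξ Y) x = inner ℝ (S.ξ x) (nabla X Y x)
      - inner ℝ (S.φ x (X x) - S.shape x (X x)) (Y x) := by
  rw [dirDeriv_metric hX S.smooth_ξ hY, Pi.add_apply, metric, metric, nabla_ξ,
    inner_sub_left, inner_sub_left]
  ring

/-- Differentiate the formula for ∇_Y(ψZ) once more. At x, η(Y) and η(Z) vanish and w ⟂ ξ, so only
derivatives of these factors survive. The terms in ⟨ξ, ∇·⟩ cancel when X and Y are antisymmetrized
and the bracket term is subtracted. -/
lemma HasSpecialDerivative.inner_nabla_nabla (h : S.HasSpecialDerivative ψ m χ)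
    (hS : S.IsContactMetric) (hm : ContMDiff I 𝓘(ℝ) ∞ m)
    (hχ : ∀ X : Π x : M, TangentSpace I x, IsSmoothField X → IsSmoothField (fun x => χ x (X x)))
    {X Y Z : Π x : M, TangentSpace I x} (hX : IsSmoothField X) (hY : IsSmoothField Y)
    (hZ : IsSmoothField Z) (hXx : (inner ℝ (S.ξ x) (X x) : ℝ) = 0)
    (hYx : (inner ℝ (S.ξ x) (Y x) : ℝ) = 0) (hZx : (inner ℝ (S.ξ x) (Z x) : ℝ) = 0)
    {w : TangentSpace I x} (hw : (inner ℝ (S.ξ x) w : ℝ) = 0) :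
    (inner ℝ (nabla X (nabla Y (ψ.app Z)) x) w : ℝ)
      = inner ℝ (ψ.toFun x (nabla X (nabla Y Z) x)) w
        + inner ℝ (S.ξ x) (nabla Y Z x)
          * inner ℝ (ψ.toFun x (S.φ x (X x) - S.shape x (X x))) w
        - inner ℝ (S.φ x (Y x) - S.shape x (Y x)) (ψ.toFun x (Z x))
          * inner ℝ (S.φ x (X x) - S.shape x (X x)) w
        + (inner ℝ (S.ξ x) (nabla X Z x) - inner ℝ (S.φ x (X x) - S.shape x (X x)) (Z x))
          * inner ℝ (ψ.toFun x (S.φ x (Y x) - S.shape x (Y x))) w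
        - m x * (inner ℝ (S.ξ x) (nabla X Y x)
          - inner ℝ (S.φ x (X x) - S.shape x (X x)) (Y x)) * inner ℝ (χ x (Z x)) w := by
  set B := S.phiEnd.app Y - (shapeEnd hS).app Y with hB
  have hBs : IsSmoothField B := (S.phiEnd.app_smooth hY).sub ((shapeEnd hS).app_smooth hY)
  have sψ := ψ.app_smooth hZ
  have s1 := metric_smooth hBs sψ
  have s2 := metric_smooth S.smooth_ξ hZ
  have s3 := hm.mul (metric_smooth S.smooth_ξ hY)
  have e : nabla Y (ψ.app Z) = ψ.app (nabla Y Z) + metric B (ψ.app Z) • S.ξ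
      + metric S.ξ Z • ψ.app B - (m * metric S.ξ Y) • (fun x => χ x (Z x)) := by
    funext y
    have h1 := EndField.nabla_app (ψ := ψ) hY hZ y
    rw [h] at h1
    refine h1.trans ?_
    simp only [B, EndField.app, Pi.add_apply, Pi.sub_apply, Pi.smul_apply', metric,
      Pi.mul_apply, phiEnd_toFun, shapeEnd_toFun]
    module
  have h1 := EndField.nabla_app (ψ := ψ) hX (nabla_smooth hY hZ) x
  rw [h, hXx] at h1
  change nabla X (ψ.app (nabla Y Z)) x = _ at h1
  have t1 := S.smooth_ξ.smul s1
  have t2 := (ψ.app_smooth hBs).smul s2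
  have t3 := (hχ Z hZ).smul s3
  have t0 := ψ.app_smooth (nabla_smooth hY hZ)
  rw [e, nabla_sub ((t0.add t1).add t2) t3, nabla_add (t0.add t1) t2, nabla_add t0 t1,
    nabla_smul s1 S.smooth_ξ, nabla_smul s2 (ψ.app_smooth hBs), nabla_smul s3 (hχ Z hZ),
    dirDeriv_mul hm (metric_smooth S.smooth_ξ hY)]
  simp only [Pi.add_apply, Pi.sub_apply, Pi.smul_apply', Pi.mul_apply, h1, nabla_ξ,
    inner_ξ_nabla hX hZ, inner_ξ_nabla hX hY, inner_add_left, inner_sub_left, inner_smul_left,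
    hw]
  simp only [metric, hYx, hZx, B, EndField.app, Pi.sub_apply, phiEnd_toFun, shapeEnd_toFun]
  simp [inner_sub_left]
  ring

/-- The Ricci identity for `ψ`, in horizontal directions. -/
lemma HasSpecialDerivative.inner_curvature (h : S.HasSpecialDerivative ψ m χ)
    (hS : S.IsContactMetric) (hm : ContMDiff I 𝓘(ℝ) ∞ m)
    (hχ : ∀ X : Π x : M, TangentSpace I x, IsSmoothField X → IsSmoothField (fun x => χ x (X x)))
    {X Y Z : Π x : M, TangentSpace I x} (hX : IsSmoothField X) (hY : IsSmoothField Y)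
    (hZ : IsSmoothField Z) (hXx : (inner ℝ (S.ξ x) (X x) : ℝ) = 0)
    (hYx : (inner ℝ (S.ξ x) (Y x) : ℝ) = 0) (hZx : (inner ℝ (S.ξ x) (Z x) : ℝ) = 0)
    {w : TangentSpace I x} (hw : (inner ℝ (S.ξ x) w : ℝ) = 0) :
    (inner ℝ (curvature X Y (ψ.app Z) x) w : ℝ)
        - ψ.sign * inner ℝ (curvature X Y Z x) (ψ.toFun x w)
      = inner ℝ (S.φ x (X x) - S.shape x (X x)) (ψ.toFun x (Z x))
          * inner ℝ (S.φ x (Y x) - S.shape x (Y x)) w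
        - inner ℝ (S.φ x (Y x) - S.shape x (Y x)) (ψ.toFun x (Z x))
          * inner ℝ (S.φ x (X x) - S.shape x (X x)) w
        + inner ℝ (S.φ x (Y x) - S.shape x (Y x)) (Z x)
          * inner ℝ (ψ.toFun x (S.φ x (X x) - S.shape x (X x))) w
        - inner ℝ (S.φ x (X x) - S.shape x (X x)) (Z x)
          * inner ℝ (ψ.toFun x (S.φ x (Y x) - S.shape x (Y x))) w
        + m x * (inner ℝ (S.φ x (X x) - S.shape x (X x)) (Y x)
          - inner ℝ (S.φ x (Y x) - S.shape x (Y x)) (X x)) * inner ℝ (χ x (Z x)) w := by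
  have h1 := h.inner_nabla_nabla hS hm hχ hX hY hZ hXx hYx hZx hw
  have h2 := h.inner_nabla_nabla hS hm hχ hY hX hZ hYx hXx hZx hw
  have h3 := EndField.nabla_app (ψ := ψ) (mlieBracket_smooth hX hY) hZ x
  rw [h, hZx] at h3
  change nabla (mlieBracket I X Y) (ψ.app Z) x = _ at h3
  have h4 := congrArg (fun v => (inner ℝ v w : ℝ)) h3
  have h5 : (inner ℝ (S.ξ x) (mlieBracket I X Y x) : ℝ)
      = inner ℝ (S.ξ x) (nabla X Y x) - inner ℝ (S.ξ x) (nabla Y X x) := by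
    rw [mlieBracket_eq hX hY, Pi.sub_apply, inner_sub_right]
  rw [← ψ.inner_left, curvature_eq, curvature_eq]
  simp only [Pi.sub_apply]
  generalize S.φ x (X x) - S.shape x (X x) = a at *
  generalize S.φ x (Y x) - S.shape x (Y x) = b at *
  simp only [inner_add_left, inner_sub_left, inner_smul_left, hw, h5, map_sub, zero_smul] at h4 ⊢
  simp only [h1, h2]
  simp at h4 ⊢
  linear_combination -h4

end AlmostContactMetric

/-! ### Linear equations for the coefficient functions -/

namespace AlmostContactMetric

variable {S : AlmostContactMetric I M}

/-- The curvature of a generalized space form on horizontal vectors. -/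
def horizontalCurvature (S : AlmostContactMetric I M) (a₁ a₂ a₄ a₅ a₇ : ℝ) (x : M)
    (u v z w : TangentSpace I x) : ℝ :=
  a₁ * (inner ℝ v z * inner ℝ u w - inner ℝ u z * inner ℝ v w)
  + a₂ * (inner ℝ u (S.φ x z) * inner ℝ (S.φ x v) w - inner ℝ v (S.φ x z) * inner ℝ (S.φ x u) w
    + 2 * inner ℝ u (S.φ x v) * inner ℝ (S.φ x z) w)
  + a₄ * (inner ℝ v z * inner ℝ (S.φ x (S.shape x u)) w
    - inner ℝ u z * inner ℝ (S.φ x (S.shape x v)) w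
    + inner ℝ (S.φ x (S.shape x v)) z * inner ℝ u w
    - inner ℝ (S.φ x (S.shape x u)) z * inner ℝ v w)
  + a₅ * (inner ℝ (S.φ x (S.shape x v)) z * inner ℝ (S.φ x (S.shape x u)) w
    - inner ℝ (S.φ x (S.shape x u)) z * inner ℝ (S.φ x (S.shape x v)) w
    + inner ℝ (S.shape x u) z * inner ℝ (S.shape x v) w
    - inner ℝ (S.shape x v) z * inner ℝ (S.shape x u) w)
  - a₇ * (inner ℝ v z * inner ℝ (S.shape x u) w - inner ℝ u z * inner ℝ (S.shape x v) w
    + inner ℝ (S.shape x v) z * inner ℝ u w - inner ℝ (S.shape x u) z * inner ℝ v w)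

variable [T2Space M] {f₁ f₂ f₃ f₄ f₅ f₆ f₇ f₈ : M → ℝ} {x : M}

lemma inner_ξ_shape (hS : S.IsContactMetric) (u : TangentSpace I x) :
    (inner ℝ (S.ξ x) (S.shape x u) : ℝ) = 0 := by
  rw [← inner_shape_left hS, shape_ξ hS, inner_zero_left]

/-- Each term of R₃, R₆ and R₈ contains η(X), η(Y) or ξ, so f₃, f₆, f₈ disappear. -/
lemma inner_curvature_eq (hS : S.IsContactMetric)
    (hR : S.IsGeneralizedSpaceForm f₁ f₂ f₃ f₄ f₅ f₆ f₇ f₈)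
    {X Y Z : Π x : M, TangentSpace I x} (hX : IsSmoothField X) (hY : IsSmoothField Y)
    (hZ : IsSmoothField Z) (hXx : (inner ℝ (S.ξ x) (X x) : ℝ) = 0)
    (hYx : (inner ℝ (S.ξ x) (Y x) : ℝ) = 0) {w : TangentSpace I x}
    (hw : (inner ℝ (S.ξ x) w : ℝ) = 0) :
    (inner ℝ (curvature X Y Z x) w : ℝ)
      = S.horizontalCurvature (f₁ x) (f₂ x) (f₄ x) (f₅ x) (f₇ x) x (X x) (Y x) (Z x) w := by
  rw [hR.curvature_eq X Y Z hX hY hZ]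
  simp only [R₁, R₂, R₃, R₄, R₅, R₆, R₇, R₈, h_eq hS hX, h_eq hS hY, eta_eq_metric, phi, metric,
    Pi.add_apply, Pi.sub_apply, Pi.smul_apply', Pi.smul_apply, Pi.mul_apply, hXx, hYx,
    φ_φ_eq, inner_ξ_shape hS, zero_smul, add_zero, horizontalCurvature, inner_add_left,
    inner_sub_left, inner_smul_left, inner_neg_left, hw]
  simp
  ring

lemma ricci_identity_φ (hS : S.IsContactMetric)
    (hR : S.IsGeneralizedSpaceForm f₁ f₂ f₃ f₄ f₅ f₆ f₇ f₈)
    (hD : S.HasSpecialDerivative S.phiEnd 0 S.φ) {u v z w : TangentSpace I x}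
    (hu : (inner ℝ (S.ξ x) u : ℝ) = 0) (hv : (inner ℝ (S.ξ x) v : ℝ) = 0)
    (hz : (inner ℝ (S.ξ x) z : ℝ) = 0) (hw : (inner ℝ (S.ξ x) w : ℝ) = 0) :
    S.horizontalCurvature (f₁ x) (f₂ x) (f₄ x) (f₅ x) (f₇ x) x u v (S.φ x z) w
        + S.horizontalCurvature (f₁ x) (f₂ x) (f₄ x) (f₅ x) (f₇ x) x u v z (S.φ x w)
      = inner ℝ (S.φ x u - S.shape x u) (S.φ x z) * inner ℝ (S.φ x v - S.shape x v) w
        - inner ℝ (S.φ x v - S.shape x v) (S.φ x z) * inner ℝ (S.φ x u - S.shape x u) w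
        + inner ℝ (S.φ x v - S.shape x v) z * inner ℝ (S.φ x (S.φ x u - S.shape x u)) w
        - inner ℝ (S.φ x u - S.shape x u) z * inner ℝ (S.φ x (S.φ x v - S.shape x v)) w := by
  obtain ⟨X, hX, rfl⟩ := exists_smoothField (I := I) u
  obtain ⟨Y, hY, rfl⟩ := exists_smoothField (I := I) v
  obtain ⟨Z, hZ, rfl⟩ := exists_smoothField (I := I) z
  have h1 := hD.inner_curvature hS contMDiff_const (fun _ => phi_smooth) hX hY hZ hu hv hz hw
  rw [phiEnd_toFun, inner_curvature_eq hS hR hX hY (S.phiEnd.app_smooth hZ) hu hv hw,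
    inner_curvature_eq hS hR hX hY hZ hu hv (inner_ξ_φ w)] at h1
  simp only [Pi.zero_apply, zero_mul, add_zero] at h1
  rw [← h1, show S.phiEnd.sign = -1 from rfl, neg_one_mul, sub_neg_eq_add]
  rfl

lemma ricci_identity_shape (hS : S.IsContactMetric)
    (hR : S.IsGeneralizedSpaceForm f₁ f₂ f₃ f₄ f₅ f₆ f₇ f₈)
    (hD : S.HasSpecialDerivative (shapeEnd hS) (f₄ - f₆) (fun x => S.φ x ∘L S.shape x))
    {u v z w : TangentSpace I x}
    (hu : (inner ℝ (S.ξ x) u : ℝ) = 0) (hv : (inner ℝ (S.ξ x) v : ℝ) = 0)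
    (hz : (inner ℝ (S.ξ x) z : ℝ) = 0) (hw : (inner ℝ (S.ξ x) w : ℝ) = 0) :
    S.horizontalCurvature (f₁ x) (f₂ x) (f₄ x) (f₅ x) (f₇ x) x u v (S.shape x z) w
        - S.horizontalCurvature (f₁ x) (f₂ x) (f₄ x) (f₅ x) (f₇ x) x u v z (S.shape x w)
      = inner ℝ (S.φ x u - S.shape x u) (S.shape x z) * inner ℝ (S.φ x v - S.shape x v) w
        - inner ℝ (S.φ x v - S.shape x v) (S.shape x z) * inner ℝ (S.φ x u - S.shape x u) w
        + inner ℝ (S.φ x v - S.shape x v) z * inner ℝ (S.shape x (S.φ x u - S.shape x u)) w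
        - inner ℝ (S.φ x u - S.shape x u) z * inner ℝ (S.shape x (S.φ x v - S.shape x v)) w
        + (f₄ x - f₆ x) * (inner ℝ (S.φ x u - S.shape x u) v
          - inner ℝ (S.φ x v - S.shape x v) u) * inner ℝ (S.φ x (S.shape x z)) w := by
  obtain ⟨X, hX, rfl⟩ := exists_smoothField (I := I) u
  obtain ⟨Y, hY, rfl⟩ := exists_smoothField (I := I) v
  obtain ⟨Z, hZ, rfl⟩ := exists_smoothField (I := I) z
  have h1 := hD.inner_curvature hS (hR.smooth.2.2.2.1.sub hR.smooth.2.2.2.2.2.1)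
    (fun V hV => phi_smooth (S := S) ((shapeEnd hS).app_smooth hV)) hX hY hZ hu hv hz hw
  rw [shapeEnd_toFun, inner_curvature_eq hS hR hX hY ((shapeEnd hS).app_smooth hZ) hu hv hw,
    inner_curvature_eq hS hR hX hY hZ hu hv (inner_ξ_shape hS w)] at h1
  rw [show (shapeEnd hS).sign = 1 from rfl, one_mul] at h1
  exact h1

/-- A pair of orthonormal eigenvectors of `∇ξ + φ` in the same eigenspace, orthogonal to `ξ`. -/
structure EigPair (S : AlmostContactMetric I M) (x : M) (l : ℝ) (u v : TangentSpace I x) :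
    Prop where
  ξ_u : (inner ℝ (S.ξ x) u : ℝ) = 0
  ξ_v : (inner ℝ (S.ξ x) v : ℝ) = 0
  shape_u : S.shape x u = l • u
  shape_v : S.shape x v = l • v
  u_u : (inner ℝ u u : ℝ) = 1
  v_v : (inner ℝ v v : ℝ) = 1
  u_v : (inner ℝ u v : ℝ) = 0

namespace EigPair

variable {l : ℝ} {u v : TangentSpace I x}

/-- φ maps the l-eigenspace into the (-l)-eigenspace, which is orthogonal to it. -/
lemma inner_φ_eig (hS : S.IsContactMetric) (hl : l ≠ 0) {a b : TangentSpace I x}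
    (ha : S.shape x a = l • a) (hb : S.shape x b = l • b) :
    (inner ℝ a (S.φ x b) : ℝ) = 0 := by
  have h1 := inner_shape_left hS x a (S.φ x b)
  rw [shape_φ _ hS, ha, hb, map_smul, inner_smul_left, inner_neg_right, inner_smul_right] at h1
  have h2 : (2 * l) * (inner ℝ a (S.φ x b) : ℝ) = 0 := by
    simp at h1; linarith
  exact (mul_eq_zero.1 h2).resolve_left (by simpa using hl)

/-- The arguments of the Ricci identities are chosen among u, v, φu, φv. The identity for A yields
the first four equations in order (`e1` to `e4`), that for φ the last (`e5`). -/
lemma coefficients (h : EigPair S x l u v) (hS : S.IsContactMetric) (hl : l ≠ 0)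
    (hR : S.IsGeneralizedSpaceForm f₁ f₂ f₃ f₄ f₅ f₆ f₇ f₈)
    (hφ : S.HasSpecialDerivative S.phiEnd 0 S.φ)
    (hD : S.HasSpecialDerivative (shapeEnd hS) (f₄ - f₆) (fun x => S.φ x ∘L S.shape x)) :
    f₄ x = 1 ∧ f₅ x * l ^ 2 - f₂ x = 1 ∧ f₁ x + f₅ x * l ^ 2 = l ^ 2 ∧
      f₄ x - f₆ x = -2 * f₂ x ∧
      f₂ x + 2 * l ^ 2 * f₅ x - f₁ x + 2 * l * f₇ x = l ^ 2 - 1 := by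
  have e1 := ricci_identity_shape (w := S.φ x u) hS hR hD h.ξ_u h.ξ_v h.ξ_v (inner_ξ_φ _)
  have e2 := ricci_identity_shape hS hR hD h.ξ_u (inner_ξ_φ v) h.ξ_v (inner_ξ_φ u)
  have e3 := ricci_identity_shape hS hR hD h.ξ_u (inner_ξ_φ v) h.ξ_u (inner_ξ_φ v)
  have e4 := ricci_identity_shape hS hR hD h.ξ_u (inner_ξ_φ u) h.ξ_v (inner_ξ_φ v)
  have e5 := ricci_identity_φ (w := S.φ x u) hS hR hφ h.ξ_u h.ξ_v h.ξ_v (inner_ξ_φ _)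
  have vu : (inner ℝ v u : ℝ) = 0 := by rw [real_inner_comm, h.u_v]
  have k1 := inner_φ_eig hS hl h.shape_u h.shape_u
  have k2 := inner_φ_eig hS hl h.shape_u h.shape_v
  have k3 := inner_φ_eig hS hl h.shape_v h.shape_u
  have k4 := inner_φ_eig hS hl h.shape_v h.shape_v
  have k1' := real_inner_comm u (S.φ x u)
  have k2' := real_inner_comm u (S.φ x v)
  have k3' := real_inner_comm v (S.φ x u)
  have k4' := real_inner_comm v (S.φ x v)
  rw [k1] at k1'; rw [k2] at k2'; rw [k3] at k3'; rw [k4] at k4'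
  simp only [horizontalCurvature, h.shape_u, h.shape_v, shape_φ _ hS, map_smul, map_neg, map_sub,
    φ_φ_eq, h.ξ_u, h.ξ_v, zero_smul, add_zero, inner_sub_left, inner_neg_left,
    inner_neg_right, inner_smul_left, inner_smul_right, S.inner_φ_φ, η_eq, h.u_u, h.v_v, h.u_v, vu,
    k1, k2, k3, k4, k1', k2', k3', k4'] at e1 e2 e3 e4 e5
  simp at e1 e2 e3 e4 e5
  refine ⟨?_, ?_, ?_, ?_, by linear_combination e5⟩
  · exact mul_left_cancel₀ (pow_ne_zero 2 hl) (by linear_combination e1 / 2)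
  · exact mul_left_cancel₀ hl (by linear_combination e2 / 2)
  · exact mul_left_cancel₀ hl (by linear_combination -e3 / 2)
  · exact mul_left_cancel₀ hl (by linear_combination -e4 / 2)

lemma φ_mem (h : EigPair S x l u v) (hS : S.IsContactMetric) :
    EigPair S x (-l) (S.φ x u) (S.φ x v) where
  ξ_u := inner_ξ_φ u
  ξ_v := inner_ξ_φ v
  shape_u := by rw [shape_φ _ hS, h.shape_u, map_smul, neg_smul]
  shape_v := by rw [shape_φ _ hS, h.shape_v, map_smul, neg_smul]
  u_u := by rw [S.inner_φ_φ, η_eq, h.ξ_u, h.u_u]; ring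
  v_v := by rw [S.inner_φ_φ, η_eq, h.ξ_v, h.v_v]; ring
  u_v := by rw [S.inner_φ_φ, η_eq, h.ξ_u, h.u_v]; ring

end EigPair

lemma exists_eigPair (hS : S.IsContactMetric)
    (hR : S.IsGeneralizedSpaceForm f₁ f₂ f₃ f₄ f₅ f₆ f₇ f₈) (hE : 5 ≤ Module.finrank ℝ E)
    {l : ℝ} (hl : l * l = 1 - (f₁ - f₃) x) : ∃ u v, EigPair S x l u v := by
  have unit {z : TangentSpace I x} (hz : z ≠ 0) :
      (inner ℝ ((‖z‖⁻¹ : ℝ) • z) ((‖z‖⁻¹ : ℝ) • z) : ℝ) = 1 := by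
    rw [real_inner_self_eq_norm_sq, norm_smul, norm_inv, norm_norm,
      inv_mul_cancel₀ (norm_ne_zero_iff.2 hz), one_pow]
  have normalize {z : TangentSpace I x}
      (hz : FirstOrder.Eig (S.shape x : TangentSpace I x →ₗ[ℝ] TangentSpace I x) (S.ξ x) l z) :
      FirstOrder.Eig (S.shape x : TangentSpace I x →ₗ[ℝ] TangentSpace I x) (S.ξ x) l
        ((‖z‖⁻¹ : ℝ) • z) :=
    ⟨by rw [inner_smul_right, hz.1, mul_zero], by rw [map_smul, hz.2, smul_comm]⟩
  have h := firstOrder hS hR x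
  -- With w = 0, orthogonality is no restriction and a first eigenvector results.
  obtain ⟨u, hu, hu0, -⟩ := h.exists_eig (w := 0) hl hE ⟨inner_zero_right _, by simp⟩
  obtain ⟨v, hv, hv0, huv⟩ := h.exists_eig hl hE (normalize hu)
  exact ⟨_, _, (normalize hu).1, (normalize hv).1, (normalize hu).2, (normalize hv).2, unit hu0,
    unit hv0, by rw [inner_smul_right, huv, mul_zero]⟩

end AlmostContactMetric

/-! ### Values of the coefficients, uniqueness of κ, μ, ν, and φ-sectional curvature -/

namespace AlmostContactMetric

variable {S : AlmostContactMetric I M} [T2Space M] {f₁ f₂ f₃ f₄ f₅ f₆ f₇ f₈ : M → ℝ} {x : M}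

/-- The coefficient functions at a point at which `κ < 1`. -/
lemma coefficients_eq (hS : S.IsContactMetric)
    (hR : S.IsGeneralizedSpaceForm f₁ f₂ f₃ f₄ f₅ f₆ f₇ f₈) (hE : 5 ≤ Module.finrank ℝ E)
    (hκ : ∀ y, (f₁ - f₃) y < 1) {c : ℝ} (hc : (f₁ - f₃) x = -c) :
    f₆ x = c ∧ f₁ x = (c + 1) / 2 ∧ f₂ x = (c - 1) / 2 ∧ f₃ x = (3 * c + 1) / 2 ∧
      f₄ x = 1 ∧ f₅ x = 1 / 2 ∧ f₇ x = 0 ∧ f₈ x = 0 := by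
  have hφ : S.HasSpecialDerivative S.phiEnd 0 S.φ := fun y u v => by
    rw [D_φ_eq hS hR hE (hκ y), Pi.zero_apply, zero_mul, zero_smul, sub_zero, phiEnd_toFun]
  have hD : S.HasSpecialDerivative (shapeEnd hS) (f₄ - f₆) (fun x => S.φ x ∘L S.shape x) :=
    fun y u v => D_shape_eq hS hR hE (hκ y) u v
  have hpos : 0 < 1 - (f₁ - f₃) x := by linarith [hκ x]
  have hl := (Real.sqrt_pos.2 hpos).ne'
  have hl2 := Real.mul_self_sqrt hpos.le
  set l := Real.sqrt (1 - (f₁ - f₃) x)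
  obtain ⟨u, v, h⟩ := exists_eigPair hS hR hE hl2
  obtain ⟨h4, h2, h1, h6, h7⟩ := h.coefficients hS hl hR hφ hD
  -- Passing to φu, φv replaces l by -l, which reverses only the f₇ term and so forces f₇ = 0.
  obtain ⟨-, -, -, -, h7'⟩ := (h.φ_mem hS).coefficients hS (neg_ne_zero.2 hl) hR hφ hD
  have h8 := nu_eq_zero hS hR hE (hκ x)
  rw [hc] at hl2
  rw [Pi.sub_apply] at hc h8
  have g7 : f₇ x = 0 := mul_left_cancel₀ hl (by linear_combination (h7 - h7') / 4)
  have g5 : f₅ x = 1 / 2 := mul_left_cancel₀ (pow_ne_zero 2 hl)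
    (by linear_combination h7 / 4 + h2 / 4 + h1 / 4 - l / 2 * g7)
  rw [g5] at h1 h2
  refine ⟨?_, ?_, ?_, ?_, h4, g5, g7, by linarith⟩ <;> nlinarith

/-- Compare two expressions for R(X,ξ)ξ at a horizontal vector. -/
lemma kappaMuNu_unique (hS : S.IsContactMetric)
    (hR : S.IsGeneralizedSpaceForm f₁ f₂ f₃ f₄ f₅ f₆ f₇ f₈) {κ μ ν : M → ℝ}
    (h : S.KappaMuNuCondition κ μ ν) {u : TangentSpace I x} (hu : (inner ℝ (S.ξ x) u : ℝ) = 0) :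
    κ x • u + μ x • S.φ x (S.shape x u) - ν x • S.shape x u
      = (f₁ - f₃) x • u + (f₄ - f₆) x • S.φ x (S.shape x u) - (f₇ - f₈) x • S.shape x u := by
  obtain ⟨X, hX, rfl⟩ := exists_smoothField (I := I) u
  have h1 := curvature_ξ_eq hS hR hX S.smooth_ξ x
  rw [h X S.ξ hX S.smooth_ξ] at h1
  simp only [h_eq hS hX, h_eq hS S.smooth_ξ, eta_eq_metric, phi, metric, Pi.add_apply,
    Pi.sub_apply, Pi.smul_apply', φ_φ_eq, inner_ξ_shape hS, hu, inner_ξ_ξ, zero_smul, add_zero,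
    one_smul, sub_zero] at h1
  simp only [Pi.sub_apply]
  linear_combination (norm := module) h1

lemma kappaMuNu_eq (hS : S.IsContactMetric)
    (hR : S.IsGeneralizedSpaceForm f₁ f₂ f₃ f₄ f₅ f₆ f₇ f₈) (hE : 5 ≤ Module.finrank ℝ E)
    (hκ : (f₁ - f₃) x < 1) {κ μ ν : M → ℝ} (h : S.KappaMuNuCondition κ μ ν) :
    κ x = (f₁ - f₃) x ∧ μ x = (f₄ - f₆) x ∧ ν x = (f₇ - f₈) x := by
  have hpos : 0 < 1 - (f₁ - f₃) x := by linarith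
  have hl := (Real.sqrt_pos.2 hpos).ne'
  have hl2 := Real.mul_self_sqrt hpos.le
  set l := Real.sqrt (1 - (f₁ - f₃) x)
  -- Pairing with u gives κ - lν, pairing with φu gives lμ. The values for l and -l together
  -- separate κ from ν.
  have key {l : ℝ} (hl : l ≠ 0) {u v : TangentSpace I x} (hp : EigPair S x l u v) :
      κ x - l * ν x = (f₁ - f₃) x - l * (f₇ - f₈) x ∧ μ x = (f₄ - f₆) x := by
    have h1 := kappaMuNu_unique hS hR h hp.ξ_u
    have k := EigPair.inner_φ_eig hS hl hp.shape_u hp.shape_u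
    have k' := real_inner_comm u (S.φ x u)
    rw [k] at k'
    have h2 := congrArg (fun v => (inner ℝ v u : ℝ)) h1
    have h3 := congrArg (fun v => (inner ℝ v (S.φ x u) : ℝ)) h1
    simp only [hp.shape_u, map_smul, inner_sub_left, inner_add_left, inner_smul_left, k, k',
      hp.u_u, S.inner_φ_φ, η_eq, hp.ξ_u] at h2 h3
    simp at h2 h3
    refine ⟨?_, ?_⟩
    · rw [Pi.sub_apply, Pi.sub_apply]; linarith
    · rw [Pi.sub_apply]; exact h3.resolve_right hl
  obtain ⟨u, v, hp⟩ := exists_eigPair hS hR hE hl2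
  obtain ⟨h1, h2⟩ := key hl hp
  obtain ⟨h3, -⟩ := key (neg_ne_zero.2 hl) (hp.φ_mem hS)
  exact ⟨by linarith, h2, mul_left_cancel₀ hl (by linarith)⟩

/-- The contributions of f₄, f₅ and f₇ cancel because A anticommutes with φ. -/
lemma inner_curvature_φ (hS : S.IsContactMetric)
    (hR : S.IsGeneralizedSpaceForm f₁ f₂ f₃ f₄ f₅ f₆ f₇ f₈) {X : Π x : M, TangentSpace I x}
    (hX : IsSmoothField X) (h1 : (inner ℝ (X x) (X x) : ℝ) = 1)
    (h0 : (inner ℝ (X x) (S.ξ x) : ℝ) = 0) :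
    metric (curvature X (S.phi X) (S.phi X)) X x = f₁ x + 3 * f₂ x := by
  rw [real_inner_comm] at h0
  rw [metric, inner_curvature_eq hS hR hX (phi_smooth hX) (phi_smooth hX) h0 (inner_ξ_φ _) h0]
  have e1 : (inner ℝ (X x) (S.φ x (X x)) : ℝ) = 0 := by
    have := inner_φ_left (S := S) (X x) (X x)
    rw [real_inner_comm] at this
    linarith
  have e1' : (inner ℝ (S.φ x (X x)) (X x) : ℝ) = 0 := by rw [real_inner_comm, e1]
  simp only [horizontalCurvature, phi, shape_φ _ hS, map_neg, φ_φ_eq, h0, inner_ξ_shape hS,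
    zero_smul, add_zero, S.inner_φ_φ, η_eq, inner_neg_left, inner_neg_right, h1, e1, e1',
    inner_φ_left (S := S) (S.shape x (X x))]
  ring

end AlmostContactMetric

end ContactGeometry

end

open ContactGeometry ContactGeometry.AlmostContactMetric
theorem theorem4p3 {n : ℕ} (hn : 2 ≤ n) {M : Type*} [TopologicalSpace M] [T2Space M]
    [ConnectedSpace M] [ChartedSpace (EuclideanSpace ℝ (Fin (2 * n + 1))) M]
    [IsManifold (𝓡 (2 * n + 1)) ∞ M]
    [RiemannianBundle (fun x : M => TangentSpace (𝓡 (2 * n + 1)) x)]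
    [IsContMDiffRiemannianBundle (𝓡 (2 * n + 1)) ∞ (EuclideanSpace ℝ (Fin (2 * n + 1)))
      (fun x : M => TangentSpace (𝓡 (2 * n + 1)) x)]
    (S : ContactGeometry.AlmostContactMetric (𝓡 (2 * n + 1)) M) (hS : S.IsContactMetric)
    (hh : S.HNeZero) (f₁ f₂ f₃ f₄ f₅ f₆ f₇ f₈ : M → ℝ)
    (hR : S.IsGeneralizedSpaceForm f₁ f₂ f₃ f₄ f₅ f₆ f₇ f₈) :
    ∃ c : ℝ, -1 < c ∧
      (∀ x, f₆ x = c ∧ f₁ x = (c + 1) / 2 ∧ f₂ x = (c - 1) / 2 ∧ f₃ x = (3 * c + 1) / 2 ∧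
        f₄ x = 1 ∧ f₅ x = 1 / 2 ∧ f₇ x = 0 ∧ f₈ x = 0) ∧
      (∀ κ μ ν : M → ℝ, S.KappaMuNuCondition κ μ ν →
        ∀ x, κ x = -c ∧ μ x = 1 - c ∧ ν x = 0) ∧
      S.IsKappaMuSpace (-c) (1 - c) ∧
      S.HasConstantPhiSectionalCurvature (2 * c - 1) := by

  have hE : 5 ≤ Module.finrank ℝ (EuclideanSpace ℝ (Fin (2 * n + 1))) := by
    rw [finrank_euclideanSpace_fin]; omega
  obtain ⟨p⟩ := ‹ConnectedSpace M›.toNonempty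
  have hκ := kappa_lt_one hS hR hE hh
  -- The constant is c = -κ, so κ < 1 becomes -1 < c.
  obtain ⟨c, hc⟩ : ∃ c : ℝ, ∀ x, (f₁ - f₃) x = -c :=
    ⟨-(f₁ - f₃) p, fun x => by rw [neg_neg, kappa_const hS hR hE x p]⟩
  have hf := fun x => coefficients_eq hS hR hE hκ (hc x)
  have hμ (x : M) : (f₄ - f₆) x = 1 - c := by
    obtain ⟨h6, -, -, -, h4, -⟩ := hf x
    rw [Pi.sub_apply, h4, h6]
  have hν (x : M) : (f₇ - f₈) x = 0 := nu_eq_zero hS hR hE (hκ x)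
  refine ⟨c, by linarith [hκ p, hc p], hf, fun κ μ ν h x => ?_, ⟨hS, fun X Y hX hY => ?_⟩,
    fun X hX x h1 h0 => ?_⟩
  · obtain ⟨h1, h2, h3⟩ := kappaMuNu_eq hS hR hE (hκ x) h
    exact ⟨h1.trans (hc x), h2.trans (hμ x), h3.trans (hν x)⟩
  · funext x
    rw [curvature_ξ_eq hS hR hX hY x, hc, hμ, hν]
    simp [h_eq hS hX, h_eq hS hY, eta_eq_metric, metric]
  · obtain ⟨-, g1, g2, -⟩ := hf x
    rw [inner_curvature_φ hS hR hX h1 h0, g1, g2]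
    ring
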